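/- Let $D$ be an integral domain with quotient field $K$. For an overring $R$ of $D$ (a ring $D\subseteq R\subseteq K$) let $\overline{\boldsymbol F}(R)$ be the set of nonzero $R$-submodules of $K$. A semistar operation on $R$ is a map $\star:\overline{\boldsymbol F}(R)\to\overline{\boldsymbol F}(R)$, $E\mapsto E^\star$, such that for all $0\neq x\in K$ and $E,F\in\overline{\boldsymbol F}(R)$: $(xE)^\star=xE^\star$; $E\subseteq F$ implies $E^\star\subseteq F^\star$; $E\subseteq E^\star$ and $(E^\star)^\star=E^\star$. For a semistar operation $\star$ on $R$: * $\star_f$ is the semistar operation $E^{\star_f}=\bigcup\{F^\star\mid F\subseteq E,\ F\neq 0 \text{ a finitely generated } R\text{-submodule of } K\}$. * A quasi-$\star$-ideal is a nonzero ideal $I$ of $R$ with $I=I^\star\cap R$. $\mathcal M(\star)$ is the set of maximal elements of the set of proper quasi-$\star$-ideals (they are prime ideals). * $\tilde\star$ is the semistar operation $E^{\tilde\star}=\bigcap\{ER_Q\mid Q\in\mathcal M(\star_f)\}$ (equal to $K$ if $\mathcal M(\star_f)=\emptyset$). * $R$ is $\star$-Noetherian if it has the ascending chain condition on quasi-$\star$-ideals.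 $R$ is a P$\star$MD if $(II^{-1})^{\star_f}=R^{\star}$ for every nonzero finitely generated ideal $I$ of $R$, where $I^{-1}=(R:_KI)$. $R$ is a $\star$-Dedekind domain ($\star$-DD) if it is $\star$-Noetherian and a P$\star$MD. * $R^\star$ is an overring of $R$, and $\dot\star$ is the semistar operation on $R^\star$ given by $E^{\dot\star}=E^\star$ for $E\in\overline{\boldsymbol F}(R^\star)$. The $t$-operation of $R$ is $t_R=(v_R)_f$, where $E^{v_R}=(R:_K(R:_KE))$. A Krull domain is an integral domain that is the intersection of a family of discrete valuation rings of its quotient field such that each nonzero element of the quotient field is a unit in all but finitely many of them (the empty family is allowed, so fields are Krull domains). **Theorem.** Let $D$ be an integral domain and $\star$ a semistar operation on $D$. The following are equivalent: 1. $D$ is a $\star$-DD. 2. $D$ is a $\tilde\star$-DD. 3. $D^{\tilde\star}$ is a $\dot{\tilde\star}$-DD. 4. $D^{\tilde\star}$ is a Krull domain and $\dot{\tilde\star}=t_{D^{\tilde\star}}$. -/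

import Mathlib

section Semistar

open scoped Pointwise

universe u v

/-- A semistar operation on an integral domain `R` with quotient field `K`: a map `E ↦ E^⋆` on the
nonzero `R`-submodules of `K` such that `(xE)^⋆ = x E^⋆` for `x ≠ 0` in `K`, `E ⊆ F` implies
`E^⋆ ⊆ F^⋆`, `E ⊆ E^⋆`, and `E^⋆⋆ = E^⋆`.  The map is extended to all submodules by the
normalization `⊥^⋆ = ⊥`; hence two semistar operations are equal if and only if they agree on
all nonzero submodules. -/
@[ext]
structure SemistarOperation (R : Type u) (K : Type v) [CommRing R] [Field K] [Algebra R K] where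
  toFun : Submodule R K → Submodule R K
  map_bot : toFun ⊥ = ⊥
  map_smul : ∀ x : K, x ≠ 0 → ∀ E : Submodule R K, E ≠ ⊥ → toFun (x • E) = x • toFun E
  mono : ∀ E F : Submodule R K, E ≠ ⊥ → F ≠ ⊥ → E ≤ F → toFun E ≤ toFun F
  le_self : ∀ E : Submodule R K, E ≠ ⊥ → E ≤ toFun E
  idem : ∀ E : Submodule R K, E ≠ ⊥ → toFun (toFun E) = toFun E

namespace SemistarOperation

variable {R : Type u} {K : Type v} [CommRing R] [Field K] [Algebra R K]

instance : CoeFun (SemistarOperation R K) (fun _ => Submodule R K → Submodule R K) := ⟨toFun⟩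

theorem mem_smul_iff {x : K} (hx : x ≠ 0) (E : Submodule R K) (y : K) :
    y ∈ x • E ↔ x⁻¹ * y ∈ E := by
  rw [Submodule.mem_smul_pointwise_iff_exists]
  constructor
  · rintro ⟨z, hz, rfl⟩
    simpa [hx] using hz
  · intro h
    exact ⟨_, h, by simp [hx]⟩

theorem smul_ne_bot {x : K} (hx : x ≠ 0) {E : Submodule R K} (hE : E ≠ ⊥) : x • E ≠ ⊥ := by
  obtain ⟨y, hy, hy0⟩ := E.ne_bot_iff.1 hE
  refine (Submodule.ne_bot_iff _).2 ⟨x * y, ?_, mul_ne_zero hx hy0⟩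
  rw [mem_smul_iff hx]
  simpa [hx] using hy

theorem apply_mono (s : SemistarOperation R K) {E F : Submodule R K} (h : E ≤ F) :
    s E ≤ s F := by
  by_cases hE : E = ⊥
  · rw [hE, s.map_bot]
    exact bot_le
  · exact s.mono E F hE (fun hF => hE (le_bot_iff.1 (hF ▸ h))) h

theorem le_apply (s : SemistarOperation R K) (E : Submodule R K) : E ≤ s E := by
  by_cases hE : E = ⊥
  · rw [hE]
    exact bot_le
  · exact s.le_self E hE

theorem apply_apply (s : SemistarOperation R K) (E : Submodule R K) : s (s E) = s E := by
  by_cases hE : E = ⊥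
  · rw [hE, s.map_bot, s.map_bot]
  · exact s.idem E hE

theorem apply_smul (s : SemistarOperation R K) {x : K} (hx : x ≠ 0) (E : Submodule R K) :
    s (x • E) = x • s E := by
  by_cases hE : E = ⊥
  · subst hE
    have h : x • (⊥ : Submodule R K) = ⊥ := by
      ext y
      rw [mem_smul_iff hx]
      simp [hx]
    rw [h, s.map_bot, h]
  · exact s.map_smul x hx E hE

/-- If `x E ⊆ F` then `x E^⋆ ⊆ F^⋆`. -/
theorem mul_mem_apply (s : SemistarOperation R K) {x y : K} {E F : Submodule R K}
    (h : ∀ z ∈ E, x * z ∈ F) (hy : y ∈ s E) : x * y ∈ s F := by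
  by_cases hx : x = 0
  · simp [hx]
  · have h1 : x • E ≤ F := by
      intro z hz
      rw [mem_smul_iff hx] at hz
      simpa [hx] using h _ hz
    apply s.apply_mono h1
    rw [s.apply_smul hx, mem_smul_iff hx]
    simpa [hx] using hy

open scoped Classical in
/-- A map satisfying the semistar axioms on the nonzero submodules, regarded as a semistar
operation (its value at `⊥` is replaced by `⊥`). -/
noncomputable def ofNeBot (f : Submodule R K → Submodule R K)
    (h1 : ∀ x : K, x ≠ 0 → ∀ E : Submodule R K, E ≠ ⊥ → f (x • E) = x • f E)
    (h2 : ∀ E F : Submodule R K, E ≠ ⊥ → F ≠ ⊥ → E ≤ F → f E ≤ f F)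
    (h3 : ∀ E : Submodule R K, E ≠ ⊥ → E ≤ f E)
    (h4 : ∀ E : Submodule R K, E ≠ ⊥ → f (f E) = f E) : SemistarOperation R K where
  toFun E := if E = ⊥ then ⊥ else f E
  map_bot := if_pos rfl
  map_smul x hx E hE := by
    rw [if_neg hE, if_neg (smul_ne_bot hx hE), h1 x hx E hE]
  mono E F hE hF h := by
    rw [if_neg hE, if_neg hF]
    exact h2 E F hE hF h
  le_self E hE := by
    rw [if_neg hE]
    exact h3 E hE
  idem E hE := by
    have : f E ≠ ⊥ := fun h => hE (le_bot_iff.1 (h ▸ h3 E hE))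
    rw [if_neg hE, if_neg this, h4 E hE]

theorem ofNeBot_apply (f : Submodule R K → Submodule R K) (h1 h2 h3 h4)
    {E : Submodule R K} (hE : E ≠ ⊥) : ofNeBot f h1 h2 h3 h4 E = f E := if_neg hE

/-- The semistar operation of finite type `⋆_f` associated to `⋆`: `E^{⋆_f}` is the union of the
`F^⋆`, where `F` ranges over the finitely generated submodules of `E`. -/
def finiteType (s : SemistarOperation R K) : SemistarOperation R K where
  toFun E :=
    { carrier := {x | ∃ F : Submodule R K, F.FG ∧ F ≤ E ∧ x ∈ s F}
      zero_mem' := ⟨⊥, Submodule.fg_bot, bot_le, zero_mem _⟩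
      add_mem' := by
        rintro x y ⟨F, hF, hFE, hx⟩ ⟨G, hG, hGE, hy⟩
        exact ⟨F ⊔ G, hF.sup hG, sup_le hFE hGE,
          add_mem (s.apply_mono le_sup_left hx) (s.apply_mono le_sup_right hy)⟩
      smul_mem' := by
        rintro c x ⟨F, hF, hFE, hx⟩
        exact ⟨F, hF, hFE, Submodule.smul_mem _ c hx⟩ }
  map_bot := by
    refine le_bot_iff.1 ?_
    rintro x ⟨F, -, hF, hx⟩
    rw [le_bot_iff.1 hF, s.map_bot] at hx
    exact hx
  map_smul x hx E _ := by
    have key : ∀ (x : K) (_ : x ≠ 0) (E : Submodule R K) (F : Submodule R K), F.FG → F ≤ E →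
        (x • F).FG ∧ x • F ≤ x • E := fun x _ E F hF hFE =>
      ⟨hF.map _, Submodule.map_mono hFE⟩
    ext y
    rw [mem_smul_iff hx]
    constructor
    · rintro ⟨F, hF, hFE, hy⟩
      obtain ⟨h1, h2⟩ := key x⁻¹ (inv_ne_zero hx) _ F hF hFE
      refine ⟨x⁻¹ • F, h1, ?_, ?_⟩
      · rwa [inv_smul_smul₀ hx] at h2
      · rw [s.apply_smul (inv_ne_zero hx), mem_smul_iff (inv_ne_zero hx)]
        simpa [hx] using hy
    · rintro ⟨F, hF, hFE, hy⟩
      obtain ⟨h1, h2⟩ := key x hx _ F hF hFE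
      refine ⟨x • F, h1, h2, ?_⟩
      rw [s.apply_smul hx, mem_smul_iff hx]
      exact hy
  mono E F _ _ h := by
    rintro x ⟨G, hG, hGE, hx⟩
    exact ⟨G, hG, hGE.trans h, hx⟩
  le_self E _ := by
    intro x hx
    exact ⟨Submodule.span R {x}, Submodule.fg_span_singleton x,
      (Submodule.span_singleton_le_iff_mem _ _).2 hx,
      s.le_apply _ (Submodule.mem_span_singleton_self x)⟩
  idem E _ := by
    apply le_antisymm
    · rintro x ⟨G, hG, hGE, hx⟩
      have main : ∀ G : Submodule R K, G.FG →
          (∀ y ∈ G, ∃ F : Submodule R K, F.FG ∧ F ≤ E ∧ y ∈ s F) →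
          ∃ F : Submodule R K, F.FG ∧ F ≤ E ∧ G ≤ s F := by
        intro G hG
        induction G, hG using Submodule.fg_induction with
        | singleton y =>
          intro h
          obtain ⟨F, h1, h2, h3⟩ := h y (Submodule.mem_span_singleton_self y)
          exact ⟨F, h1, h2, (Submodule.span_singleton_le_iff_mem _ _).2 h3⟩
        | sup A B hA hB ihA ihB =>
          intro h
          obtain ⟨F, h1, h2, h3⟩ := ihA fun y hy => h y (le_sup_left (a := A) (b := B) hy)
          obtain ⟨F', h1', h2', h3'⟩ := ihB fun y hy => h y (le_sup_right (a := A) (b := B) hy)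
          exact ⟨F ⊔ F', h1.sup h1', sup_le h2 h2',
            sup_le (h3.trans (s.apply_mono le_sup_left)) (h3'.trans (s.apply_mono le_sup_right))⟩
      obtain ⟨F, h1, h2, h3⟩ := main G hG (fun y hy => hGE hy)
      refine ⟨F, h1, h2, ?_⟩
      rw [← s.apply_apply F]
      exact s.apply_mono h3 hx
    · intro x hx
      exact ⟨Submodule.span R {x}, Submodule.fg_span_singleton x,
        (Submodule.span_singleton_le_iff_mem _ _).2 hx,
        s.le_apply _ (Submodule.mem_span_singleton_self x)⟩

/-- The ideal `I^⋆ ∩ R` of `R`. -/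
def trace (s : SemistarOperation R K) (I : Ideal R) : Ideal R :=
  Submodule.comap (Algebra.linearMap R K) (s (IsLocalization.coeSubmodule K I))

/-- A quasi-`⋆`-ideal: a nonzero ideal `I` of `R` with `I = I^⋆ ∩ R`. -/
def IsQuasiIdeal (s : SemistarOperation R K) (I : Ideal R) : Prop :=
  I ≠ ⊥ ∧ I = s.trace I

/-- A quasi-`⋆`-maximal ideal: a maximal element of the set of proper quasi-`⋆`-ideals. -/
def IsQuasiMaximal (s : SemistarOperation R K) (M : Ideal R) : Prop :=
  Maximal (fun I : Ideal R => s.IsQuasiIdeal I ∧ I ≠ ⊤) M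

theorem mem_trace (s : SemistarOperation R K) (I : Ideal R) (a : R) :
    a ∈ s.trace I ↔ algebraMap R K a ∈ s (IsLocalization.coeSubmodule K I) := Iff.rfl

/-- Quasi-`⋆`-maximal ideals are prime. -/
theorem IsQuasiMaximal.isPrime {s : SemistarOperation R K} {M : Ideal R}
    (hM : s.IsQuasiMaximal M) : M.IsPrime := by
  refine ⟨hM.prop.2, ?_⟩
  intro a b hab
  by_contra! hcon
  obtain ⟨ha, hb⟩ := hcon
  have le_trace : ∀ I : Ideal R, I ≤ s.trace I := fun I c hc =>
    s.le_apply _ ((IsLocalization.mem_coeSubmodule K I).2 ⟨c, hc, rfl⟩)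
  let J : Ideal R := M ⊔ Ideal.span {a}
  have hMJ : M ≤ J := le_sup_left
  have haJ : a ∈ J := le_sup_right (a := M) (b := Ideal.span {a}) (Ideal.mem_span_singleton_self a)
  have hq : s.IsQuasiIdeal (s.trace J) := by
    constructor
    · intro h
      exact hM.prop.1.1 (le_bot_iff.1 (h ▸ hMJ.trans (le_trace J)))
    · apply le_antisymm (le_trace _)
      intro c hc
      rw [mem_trace] at hc ⊢
      rw [← s.apply_apply]
      refine s.apply_mono ?_ hc
      intro y hy
      obtain ⟨z, hz, rfl⟩ := (IsLocalization.mem_coeSubmodule K _).1 hy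
      exact hz
  have htop : s.trace J = ⊤ := by
    by_contra hne
    have := hM.le_of_ge ⟨hq, hne⟩ (hMJ.trans (le_trace J))
    exact ha (this (le_trace J haJ))
  have h1 : algebraMap R K 1 ∈ s (IsLocalization.coeSubmodule K J) := by
    rw [← mem_trace, htop]
    trivial
  have h2 : algebraMap R K b * algebraMap R K 1 ∈ s (IsLocalization.coeSubmodule K M) := by
    refine s.mul_mem_apply ?_ h1
    intro z hz
    obtain ⟨c, hc, rfl⟩ := (IsLocalization.mem_coeSubmodule K _).1 hz
    refine (IsLocalization.mem_coeSubmodule K _).2 ⟨b * c, ?_, map_mul _ _ _⟩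
    obtain ⟨m, hm, n, hn, rfl⟩ := Submodule.mem_sup.1 hc
    obtain ⟨d, rfl⟩ := Ideal.mem_span_singleton'.1 hn
    rw [mul_add]
    refine add_mem (M.mul_mem_left _ hm) ?_
    have : b * (d * a) = d * (a * b) := by ring
    rw [this]
    exact M.mul_mem_left _ hab
  rw [← map_mul, mul_one, ← mem_trace, ← hM.prop.1.2] at h2
  exact hb h2

/-- `R` is `⋆`-Noetherian: the ascending chain condition holds for quasi-`⋆`-ideals. -/
def IsNoetherianDomain (s : SemistarOperation R K) : Prop :=
  ∀ I : ℕ → Ideal R, Monotone I → (∀ n, s.IsQuasiIdeal (I n)) → ∃ n, ∀ m, n ≤ m → I m = I n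

/-- `E` is `⋆`-invertible: `(E E⁻¹)^⋆ = R^⋆`, where `E⁻¹ = (R :_K E)`. -/
def IsInvertible (s : SemistarOperation R K) (E : Submodule R K) : Prop :=
  s (E * (1 / E)) = s 1

/-- `R` is a Prüfer `⋆`-multiplication domain: each nonzero finitely generated ideal of `R` is
`⋆_f`-invertible. -/
def IsPruferMultiplicationDomain (s : SemistarOperation R K) : Prop :=
  ∀ I : Ideal R, I ≠ ⊥ → I.FG → s.finiteType.IsInvertible (IsLocalization.coeSubmodule K I)

/-- `R` is a `⋆`-Dedekind domain. -/
def IsDedekind (s : SemistarOperation R K) : Prop :=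
  s.IsNoetherianDomain ∧ s.IsPruferMultiplicationDomain

/-- The overring `R^⋆` of `R` in `K`. -/
def overring (s : SemistarOperation R K) : Subalgebra R K where
  carrier := {x | x ∈ s 1}
  mul_mem' := by
    intro x y hx hy
    have h : x * y ∈ s (s 1) := by
      refine s.mul_mem_apply (E := 1) ?_ hy
      intro z hz
      obtain ⟨c, rfl⟩ := Submodule.mem_one.1 hz
      rw [mul_comm, ← Algebra.smul_def]
      exact Submodule.smul_mem _ c hx
    rwa [s.apply_apply] at h
  add_mem' hx hy := add_mem (S := Submodule R K) hx hy
  algebraMap_mem' c := s.le_apply 1 (Submodule.mem_one.2 ⟨c, rfl⟩)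

/-- The semistar operation induced by `⋆` on an overring `T` of `R`: a `T`-submodule `E` of `K` is
sent to `E^⋆`, where `E` is regarded as an `R`-submodule (`E^⋆` is again a `T`-submodule). -/
def induced (s : SemistarOperation R K) (T : Subalgebra R K) : SemistarOperation T K where
  toFun E :=
    { carrier := {x | x ∈ s (E.restrictScalars R)}
      zero_mem' := zero_mem (s (E.restrictScalars R))
      add_mem' := fun hx hy => add_mem (S := Submodule R K) hx hy
      smul_mem' := by
        intro t x hx
        exact s.mul_mem_apply (x := (t : K)) (fun z hz => E.smul_mem t hz) hx }
  map_bot := by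
    refine le_bot_iff.1 ?_
    intro x hx
    have h : x ∈ s (Submodule.restrictScalars R (⊥ : Submodule T K)) := hx
    rw [Submodule.restrictScalars_bot, s.map_bot] at h
    exact h
  map_smul x hx E _ := by
    have h : (x • E).restrictScalars R = x • E.restrictScalars R := by
      ext y
      rw [Submodule.restrictScalars_mem, mem_smul_iff hx, mem_smul_iff hx,
        Submodule.restrictScalars_mem]
    ext y
    rw [mem_smul_iff hx]
    change y ∈ s ((x • E).restrictScalars R) ↔ x⁻¹ * y ∈ s (E.restrictScalars R)
    rw [h, s.apply_smul hx, mem_smul_iff hx]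
  mono E F _ _ h := fun x hx => s.apply_mono (F := F.restrictScalars R) (fun _ hy => h hy) hx
  le_self E _ := fun x hx => s.le_apply (E.restrictScalars R) hx
  idem E _ := by
    ext x
    change x ∈ s (s (E.restrictScalars R)) ↔ x ∈ s (E.restrictScalars R)
    rw [s.apply_apply]

/-- The semistar operation induced by `⋆` on the overring `R^⋆`. -/
def dot (s : SemistarOperation R K) : SemistarOperation s.overring K := s.induced s.overring

variable (R K) in
/-- The `v`-operation `E ↦ E^v = (E⁻¹)⁻¹`, where `E⁻¹ = (R :_K E)`. -/
noncomputable def vOperation : SemistarOperation R K :=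
  ofNeBot (fun E => 1 / (1 / E))
    (by
      intro x hx E _
      have h : ∀ (x : K), x ≠ 0 → ∀ F : Submodule R K, 1 / (x • F) = x⁻¹ • (1 / F) := by
        intro x hx F
        ext y
        rw [mem_smul_iff (inv_ne_zero hx), inv_inv, Submodule.mem_div_iff_forall_mul_mem,
          Submodule.mem_div_iff_forall_mul_mem]
        constructor
        · intro h z hz
          have := h (x * z) (by rw [mem_smul_iff hx]; simpa [hx] using hz)
          rwa [mul_assoc, mul_left_comm]
        · intro h z hz
          rw [mem_smul_iff hx] at hz
          have := h _ hz
          have e : x * y * (x⁻¹ * z) = y * z := by field_simp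
          rwa [e] at this
      rw [h x hx, h _ (inv_ne_zero hx), inv_inv])
    (by
      intro E F _ _ h x hx
      rw [Submodule.mem_div_iff_forall_mul_mem] at hx ⊢
      intro y hy
      refine hx y ?_
      rw [Submodule.mem_div_iff_forall_mul_mem] at hy ⊢
      exact fun z hz => hy z (h hz))
    (by
      intro E _ x hx
      rw [Submodule.mem_div_iff_forall_mul_mem]
      intro y hy
      rw [mul_comm]
      exact Submodule.mem_div_iff_forall_mul_mem.1 hy x hx)
    (by
      intro E _
      have h : (1 : Submodule R K) / (1 / (1 / E)) = 1 / E := by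
        ext x
        rw [Submodule.mem_div_iff_forall_mul_mem]
        constructor
        · intro h
          rw [Submodule.mem_div_iff_forall_mul_mem]
          intro y hy
          refine h y ?_
          rw [Submodule.mem_div_iff_forall_mul_mem]
          intro z hz
          rw [mul_comm]
          exact Submodule.mem_div_iff_forall_mul_mem.1 hz y hy
        · intro hx y hy
          rw [mul_comm]
          exact Submodule.mem_div_iff_forall_mul_mem.1 hy x hx
      change (1 : Submodule R K) / (1 / (1 / (1 / E))) = 1 / (1 / E)
      rw [h])

variable (R K) in
/-- The `t`-operation: the semistar operation of finite type associated to the `v`-operation. -/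
noncomputable def tOperation : SemistarOperation R K := (vOperation R K).finiteType

variable [IsDomain R] [IsFractionRing R K]

/-- The submodule `E R_P` of `K`, where `R_P ⊆ K` is the localization of `R` at the prime `P`. -/
noncomputable def localizeAt (P : PrimeSpectrum R) (E : Submodule R K) : Submodule R K :=
  E * Subalgebra.toSubmodule
    (Localization.subalgebra.ofField K P.asIdeal.primeCompl P.asIdeal.primeCompl_le_nonZeroDivisors)

theorem mem_localizeAt (P : PrimeSpectrum R) (E : Submodule R K) (x : K) :
    x ∈ localizeAt P E ↔ ∃ a ∈ P.asIdeal.primeCompl, algebraMap R K a * x ∈ E := by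
  have hne : ∀ a ∈ P.asIdeal.primeCompl, algebraMap R K a ≠ 0 := fun a ha h0 =>
    nonZeroDivisors.ne_zero (P.asIdeal.primeCompl_le_nonZeroDivisors ha)
      ((IsFractionRing.injective R K) (by rw [h0, map_zero]))
  constructor
  · intro hx
    induction hx using Submodule.mul_induction_on' with
    | mem_mul_mem m hm n hn =>
      obtain ⟨c, a, ha, rfl⟩ := hn
      refine ⟨a, ha, ?_⟩
      have e : algebraMap R K a * (m * (algebraMap R K c * (algebraMap R K a)⁻¹)) = c • m := by
        rw [Algebra.smul_def]
        have := hne a ha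
        field_simp
      rw [e]
      exact E.smul_mem c hm
    | add y _ z _ hy hz =>
      obtain ⟨a, ha, hy⟩ := hy
      obtain ⟨b, hb, hz⟩ := hz
      refine ⟨a * b, mul_mem ha hb, ?_⟩
      have e : algebraMap R K (a * b) * (y + z)
          = b • (algebraMap R K a * y) + a • (algebraMap R K b * z) := by
        rw [Algebra.smul_def, Algebra.smul_def, map_mul]
        ring
      rw [e]
      exact add_mem (E.smul_mem _ hy) (E.smul_mem _ hz)
  · rintro ⟨a, ha, hx⟩
    have e : x = algebraMap R K a * x * (algebraMap R K 1 * (algebraMap R K a)⁻¹) := by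
      have := hne a ha
      rw [map_one]
      field_simp
    rw [e]
    exact Submodule.mul_mem_mul hx ⟨1, a, ha, rfl⟩

/-- The spectral semistar operation defined by a set `Δ` of primes:
`E ↦ ⋂ {E R_P | P ∈ Δ}` (equal to `K` if `Δ` is empty). -/
noncomputable def spectral (Δ : Set (PrimeSpectrum R)) : SemistarOperation R K :=
  ofNeBot (fun E => ⨅ P ∈ Δ, localizeAt P E)
    (by
      intro x hx E _
      ext y
      rw [mem_smul_iff hx]
      simp only [Submodule.mem_iInf, mem_localizeAt, mem_smul_iff hx]
      simp only [mul_left_comm x⁻¹])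
    (by
      intro E F _ _ h x hx
      simp only [Submodule.mem_iInf, mem_localizeAt] at hx ⊢
      intro P hP
      obtain ⟨a, ha, hx⟩ := hx P hP
      exact ⟨a, ha, h hx⟩)
    (by
      intro E _ x hx
      simp only [Submodule.mem_iInf, mem_localizeAt]
      exact fun P _ => ⟨1, one_mem _, by simpa using hx⟩)
    (by
      intro E _
      ext x
      simp only [Submodule.mem_iInf, mem_localizeAt]
      constructor
      · intro h P hP
        obtain ⟨a, ha, h⟩ := h P hP
        obtain ⟨b, hb, h⟩ := h P hP
        exact ⟨b * a, mul_mem hb ha, by rwa [map_mul, mul_assoc]⟩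
      · intro h P hP
        exact ⟨1, one_mem _, fun Q hQ => by simpa using h Q hQ⟩)

/-- The semistar operation `⋆~`: the spectral semistar operation defined by the set of all
quasi-`⋆_f`-maximal ideals of `R` (each of which is prime). -/
noncomputable def tilde (s : SemistarOperation R K) : SemistarOperation R K :=
  spectral {P | s.finiteType.IsQuasiMaximal P.asIdeal}

end SemistarOperation

/-- `R`, with quotient field `K`, is a Krull domain: `R` is the intersection in `K` of a family of
discrete valuation rings of `K` such that each nonzero element of `K` is a unit in all but finitely
many of them.  (The empty family is allowed, so a field is a Krull domain.) -/
def IsKrullDomainIn (R : Type u) (K : Type v) [CommRing R] [Field K] [Algebra R K] : Prop :=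
  ∃ V : Set (ValuationSubring K),
    (∀ A ∈ V, IsDiscreteValuationRing A) ∧
    (∀ x : K, x ∈ (algebraMap R K).range ↔ ∀ A ∈ V, x ∈ A) ∧
    (∀ x : K, x ≠ 0 → {A ∈ V | A.valuation x ≠ 1}.Finite)

end Semistar

/-!
Write `J ∈ 𝓕` when `J ⊆ R` is finitely generated with `1 ∈ J^⋆`. As `⋆_f` is of finite type, Zorn's
lemma puts every nonzero ideal with `1 ∉ I^{⋆_f}` inside a quasi-`⋆_f`-maximal ideal, and therefore
`x ∈ E^{⋆~}` if and only if `J x ⊆ E` for some `J ∈ 𝓕` (`mem_tilde_iff`). In particular `⋆~` is of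
finite type, `⋆~ ≤ ⋆_f`, and both operations have the same invertible submodules.

In a P`⋆`MD one even has `⋆_f = ⋆~` (`IsPruferMultiplicationDomain.finiteType_eq_tilde`), and in a
`⋆`-Noetherian domain `⋆` and `⋆_f` agree on ideals; so `⋆`-Dedekind and `⋆~`-Dedekind mean the same
(`isDedekind_tilde_iff`). The passage to the overring `R^{⋆~}` is by extension and contraction
(`isDedekind_dot_iff`): each finite subset of `R^{⋆~}` is multiplied into `R` by some `J ∈ 𝓕`.

There remains the case of an operation of finite type with `R^⋆ = R`. If `R` is `⋆`-Dedekind, then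
invertibility of finitely generated ideals forces `⋆ = t`
(`IsPruferMultiplicationDomain.finiteType_eq_tOperation`), all nonzero ideals are principal at each
quasi-`⋆`-maximal ideal `P`, so the `R_P` are discrete valuation rings intersecting in `R^{⋆~} = R`,
and the chain condition yields finite character (`IsDedekind.finite_isQuasiMaximal`). Conversely,
a Krull domain is completely integrally closed, so that its nonzero ideals are `v`-invertible, and it
has the chain condition on divisorial ideals, since these are determined by their extensions to the
defining valuation rings. This chain condition makes `t` and `v` agree on ideals
(`IsKrullDomainIn.isDedekind_tOperation`).
-/

namespace SemistarOperation

open scoped Pointwise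
open IsLocalization (coeSubmodule mem_coeSubmodule)

/-! ### Finite type, quasi-ideals and invertibility -/

section Basic

variable {R K : Type*} [CommRing R] [Field K] [Algebra R K] (s : SemistarOperation R K)

theorem finiteType_le (E : Submodule R K) : s.finiteType E ≤ s E := by
  rintro x ⟨F, -, hFE, hx⟩
  exact s.apply_mono hFE hx

theorem finiteType_of_fg {E : Submodule R K} (hE : E.FG) : s.finiteType E = s E :=
  le_antisymm (s.finiteType_le E) fun _ hx => ⟨E, hE, le_rfl, hx⟩

theorem finiteType_finiteType : s.finiteType.finiteType = s.finiteType := by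
  ext E x
  refine ⟨fun hx => s.finiteType.finiteType_le E hx, ?_⟩
  rintro ⟨F, hF, hFE, hx⟩
  exact ⟨F, hF, hFE, by rwa [s.finiteType_of_fg hF]⟩

theorem apply_le_of_le {E F : Submodule R K} (h : E ≤ s F) : s E ≤ s F := by
  rw [← s.apply_apply F]
  exact s.apply_mono h

theorem apply_mul_apply_le (E F : Submodule R K) : s E * s F ≤ s (E * F) := by
  refine Submodule.mul_le.2 fun x hx y hy => ?_
  rw [← s.apply_apply (E * F)]
  refine s.mul_mem_apply (E := F) (fun z hz => ?_) hy
  rw [mul_comm x z]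
  refine s.mul_mem_apply (E := E) (fun w hw => ?_) hx
  rw [mul_comm z w]
  exact Submodule.mul_mem_mul hw hz

theorem one_mem_apply_mul {E F : Submodule R K} (hE : 1 ∈ s E) (hF : 1 ∈ s F) : 1 ∈ s (E * F) := by
  simpa using s.apply_mul_apply_le E F (Submodule.mul_mem_mul hE hF)

theorem coeSubmodule_le_one (I : Ideal R) : coeSubmodule K I ≤ 1 := by
  rw [← IsLocalization.coeSubmodule_top]
  exact IsLocalization.coeSubmodule_mono K le_top

theorem coeSubmodule_comap {E : Submodule R K} (hE : E ≤ 1) :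
    coeSubmodule K (Submodule.comap (Algebra.linearMap R K) E : Ideal R) = E := by
  ext x
  rw [mem_coeSubmodule]
  constructor
  · rintro ⟨a, ha, rfl⟩
    exact ha
  · intro hx
    obtain ⟨a, rfl⟩ := Submodule.mem_one.1 (hE hx)
    exact ⟨a, hx, rfl⟩

theorem coeSubmodule_trace_le (I : Ideal R) :
    coeSubmodule K (s.trace I) ≤ s (coeSubmodule K I) := by
  intro x hx
  obtain ⟨a, ha, rfl⟩ := (mem_coeSubmodule K _).1 hx
  exact ha

theorem le_trace (I : Ideal R) : I ≤ s.trace I := fun a ha =>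
  s.le_apply _ ((mem_coeSubmodule K I).2 ⟨a, ha, rfl⟩)

theorem isQuasiIdeal_iff {I : Ideal R} : s.IsQuasiIdeal I ↔ I ≠ ⊥ ∧ s.trace I ≤ I :=
  and_congr_right fun _ => ⟨fun h => h.ge, fun h => le_antisymm (s.le_trace I) h⟩

theorem trace_mono {I J : Ideal R} (h : I ≤ J) : s.trace I ≤ s.trace J := fun _ ha =>
  s.apply_mono (IsLocalization.coeSubmodule_mono K h) ha

theorem isQuasiIdeal_trace {I : Ideal R} (hI : I ≠ ⊥) : s.IsQuasiIdeal (s.trace I) := by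
  refine s.isQuasiIdeal_iff.2 ⟨fun h => hI (le_bot_iff.1 (h ▸ s.le_trace I)), fun a ha => ?_⟩
  exact s.apply_le_of_le (s.coeSubmodule_trace_le I) ha

theorem trace_eq_top_iff {I : Ideal R} : s.trace I = ⊤ ↔ 1 ∈ s (coeSubmodule K I) := by
  rw [Ideal.eq_top_iff_one, mem_trace, map_one]

theorem fg_comap [IsFractionRing R K] {F : Submodule R K} (hF : F.FG) (hF1 : F ≤ 1) :
    (Submodule.comap (Algebra.linearMap R K) F : Ideal R).FG := by
  rw [← coeSubmodule_comap hF1] at hF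
  exact (IsLocalization.coeSubmodule_fg K (IsFractionRing.injective R K) _).1 hF

theorem IsQuasiMaximal.one_notMem {s : SemistarOperation R K} {M : Ideal R}
    (hM : s.IsQuasiMaximal M) : 1 ∉ s (coeSubmodule K M) := fun h =>
  hM.prop.2 (hM.prop.1.2.trans (s.trace_eq_top_iff.2 h))

/-- The chain condition on quasi-`⋆`-ideals in maximal-element form. -/
theorem IsNoetherianDomain.exists_maximal {s : SemistarOperation R K}
    (hs : s.IsNoetherianDomain) (S : Set (Ideal R)) (hS : ∀ I ∈ S, s.IsQuasiIdeal I)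
    (hne : S.Nonempty) : ∃ I, Maximal (· ∈ S) I := by
  have hwf : WellFoundedGT {I : Ideal R // s.IsQuasiIdeal I} := by
    rw [wellFoundedGT_iff_monotone_chain_condition]
    intro a
    obtain ⟨n, hn⟩ := hs (fun k => (a k).1) (fun i j h => a.monotone h) fun k => (a k).2
    exact ⟨n, fun m hm => Subtype.ext (hn m hm).symm⟩
  obtain ⟨I₀, hI₀⟩ := hne
  obtain ⟨M, hM, hmax⟩ := hwf.wf.has_min {I | I.1 ∈ S} ⟨⟨I₀, hS I₀ hI₀⟩, hI₀⟩
  refine ⟨M.1, hM, fun N hN hMN => ?_⟩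
  by_contra hcon
  exact hmax ⟨N, hS N hN⟩ hN (lt_of_le_not_ge hMN hcon)

/-- In a `⋆`-Noetherian domain every ideal is, up to `⋆`-closure, finitely generated. -/
theorem IsNoetherianDomain.exists_fg {s : SemistarOperation R K} (hs : s.IsNoetherianDomain)
    (I : Ideal R) : ∃ J ≤ I, J.FG ∧ coeSubmodule K I ≤ s (coeSubmodule K J) := by
  by_cases hI : I = ⊥
  · exact ⟨⊥, bot_le, Submodule.fg_bot, by simp [hI]⟩
  obtain ⟨a, ha, ha0⟩ := I.ne_bot_iff.1 hI
  obtain ⟨M, ⟨J, ⟨hJ0, hJI, hJ⟩, rfl⟩, hmax⟩ :=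
    hs.exists_maximal (s.trace '' {J | J ≠ ⊥ ∧ J ≤ I ∧ J.FG})
      (by rintro _ ⟨J, hJ, rfl⟩; exact s.isQuasiIdeal_trace hJ.1)
      ⟨_, Ideal.span {a}, ⟨by simpa using ha0, by simpa [Ideal.span_le] using ha,
        Submodule.fg_span_singleton a⟩, rfl⟩
  refine ⟨J, hJI, hJ, fun x hx => ?_⟩
  obtain ⟨b, hb, rfl⟩ := (mem_coeSubmodule K _).1 hx
  have h := hmax ⟨J ⊔ Ideal.span {b}, ⟨fun h => hJ0 (le_bot_iff.1 (h ▸ le_sup_left)),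
    sup_le hJI (by simpa [Ideal.span_le] using hb),
    Submodule.FG.sup hJ (Submodule.fg_span_singleton b)⟩, rfl⟩
    (s.trace_mono le_sup_left)
  exact h (s.le_trace _ (le_sup_right (a := J) (Ideal.mem_span_singleton_self b)))

theorem IsNoetherianDomain.finiteType_coeSubmodule {s : SemistarOperation R K}
    (hs : s.IsNoetherianDomain) (I : Ideal R) :
    s.finiteType (coeSubmodule K I) = s (coeSubmodule K I) := by
  obtain ⟨J, hJI, hJ, hIJ⟩ := hs.exists_fg I
  exact le_antisymm (s.finiteType_le _) fun _ hx =>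
    ⟨_, Submodule.FG.map _ hJ, IsLocalization.coeSubmodule_mono K hJI, s.apply_le_of_le hIJ hx⟩

/-- The chain condition passes to operations with larger closures on ideals, which have fewer
quasi-ideals. -/
theorem IsNoetherianDomain.of_le {s t : SemistarOperation R K} (hs : s.IsNoetherianDomain)
    (h : ∀ I : Ideal R, s (coeSubmodule K I) ≤ t (coeSubmodule K I)) : t.IsNoetherianDomain :=
  fun I hI hq => hs I hI fun n =>
    s.isQuasiIdeal_iff.2 ⟨(hq n).1, fun _ ha => (hq n).2.ge (h _ ha)⟩

theorem isInvertible_iff {E : Submodule R K} : s.IsInvertible E ↔ 1 ∈ s (E * (1 / E)) := by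
  refine ⟨fun h => ?_, fun h => le_antisymm ?_ ?_⟩
  · rw [IsInvertible] at h
    rw [h]
    exact s.le_apply 1 (Submodule.one_le.1 le_rfl)
  · exact s.apply_mono Submodule.mul_one_div_le_one
  · exact s.apply_le_of_le (by rwa [Submodule.one_le])

theorem isInvertible_smul {x : K} (hx : x ≠ 0) {E : Submodule R K} :
    s.IsInvertible (x • E) ↔ s.IsInvertible E := by
  have h : (x • E) * (1 / (x • E)) = E * (1 / E) := by
    apply le_antisymm
    · refine Submodule.mul_le.2 fun y hy z hz => ?_
      rw [mem_smul_iff hx] at hy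
      have hz' : x * z ∈ 1 / E := Submodule.mem_div_iff_forall_mul_mem.2 fun w hw => by
        have := Submodule.mem_div_iff_forall_mul_mem.1 hz (x * w)
          (by rw [mem_smul_iff hx]; simpa [hx] using hw)
        rwa [mul_comm x, mul_assoc]
      have e : y * z = (x⁻¹ * y) * (x * z) := by field_simp
      rw [e]
      exact Submodule.mul_mem_mul hy hz'
    · refine Submodule.mul_le.2 fun y hy z hz => ?_
      have hz' : x⁻¹ * z ∈ 1 / (x • E) := Submodule.mem_div_iff_forall_mul_mem.2 fun w hw => by
        rw [mem_smul_iff hx] at hw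
        have := Submodule.mem_div_iff_forall_mul_mem.1 hz _ hw
        rwa [mul_comm x⁻¹, mul_assoc]
      have e : y * z = (x * y) * (x⁻¹ * z) := by field_simp
      rw [e]
      refine Submodule.mul_mem_mul ?_ hz'
      rw [mem_smul_iff hx]
      simpa [hx] using hy
  rw [IsInvertible, IsInvertible, h]

end Basic

/-! ### The stable operation `⋆~` -/

section Tilde

variable {R K : Type*} [CommRing R] [Field K] [Algebra R K] [IsFractionRing R K]
  (s : SemistarOperation R K)

/-- Zorn's lemma: since `⋆_f` is of finite type, every nonzero ideal `I` with `1 ∉ I^{⋆_f}` lies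
in a quasi-`⋆_f`-maximal ideal. -/
theorem exists_isQuasiMaximal {I : Ideal R} (hI : I ≠ ⊥)
    (h1 : 1 ∉ s.finiteType (coeSubmodule K I)) :
    ∃ M, s.finiteType.IsQuasiMaximal M ∧ I ≤ M := by
  obtain ⟨M, hIM, hM⟩ := zorn_le_nonempty₀
    {J : Ideal R | 1 ∉ s.finiteType (coeSubmodule K J)} (by
      intro c hc hchain J hJ
      refine ⟨sSup c, ?_, fun z hz => le_sSup hz⟩
      rintro ⟨F, hF, hFc, h1F⟩
      have hF1 : F ≤ 1 := hFc.trans (coeSubmodule_le_one _)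
      have hle : (Submodule.comap (Algebra.linearMap R K) F : Ideal R) ≤ sSup c := by
        rwa [← IsFractionRing.coeSubmodule_le_coeSubmodule (K := K), coeSubmodule_comap hF1]
      obtain ⟨N, hN, hle'⟩ := (CompleteLattice.isCompactElement_iff_le_of_directed_sSup_le _ _).1
        ((Submodule.fg_iff_compact _).1 (fg_comap hF hF1)) c ⟨J, hJ⟩ hchain.directedOn hle
      rw [← IsFractionRing.coeSubmodule_le_coeSubmodule (K := K), coeSubmodule_comap hF1] at hle'
      exact hc hN ⟨F, hF, hle', h1F⟩) I h1
  have hM0 : M ≠ ⊥ := fun h => hI (le_bot_iff.1 (h ▸ hIM))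
  have htr : s.finiteType.trace M ≤ M := hM.le_of_ge
    (fun h => hM.prop (s.finiteType.apply_le_of_le (s.finiteType.coeSubmodule_trace_le M) h))
    (s.finiteType.le_trace M)
  refine ⟨M, ⟨⟨s.finiteType.isQuasiIdeal_iff.2 ⟨hM0, htr⟩, ?_⟩, ?_⟩, hIM⟩
  · intro htop
    refine hM.prop (s.finiteType.trace_eq_top_iff.1 ?_)
    exact top_le_iff.1 (htop ▸ s.finiteType.le_trace M)
  · rintro N ⟨hN, hNtop⟩ hMN
    refine hM.le_of_ge (fun h => hNtop ?_) hMN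
    rw [hN.2]
    exact s.finiteType.trace_eq_top_iff.2 h

variable [IsDomain R]

/-- `x ∈ E^{⋆~}` if and only if `F x ⊆ E` for a finitely generated `F ⊆ R` with `1 ∈ F^⋆`. -/
theorem mem_tilde_iff {E : Submodule R K} {x : K} :
    x ∈ s.tilde E ↔ ∃ F : Submodule R K, F.FG ∧ F ≤ 1 ∧ 1 ∈ s F ∧ ∀ y ∈ F, y * x ∈ E := by
  constructor
  · intro hx
    by_cases hx0 : x = 0
    · refine ⟨1, ?_, le_rfl, s.le_apply 1 (Submodule.one_le.1 le_rfl), fun y _ => by simp [hx0]⟩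
      rw [Submodule.one_eq_span]
      exact Submodule.fg_span_singleton 1
    have hE : E ≠ ⊥ := by
      rintro rfl
      rw [map_bot] at hx
      exact hx0 hx
    rw [tilde, spectral, ofNeBot_apply _ _ _ _ _ hE] at hx
    simp only [Submodule.mem_iInf, mem_localizeAt] at hx
    let J : Ideal R := Submodule.comap (LinearMap.toSpanSingleton R K x) E
    have hJ : ∀ a, a ∈ J ↔ algebraMap R K a * x ∈ E := fun a => by
      rw [← Algebra.smul_def]
      exact Iff.rfl
    have hJ0 : J ≠ ⊥ := by
      obtain ⟨e, he, he0⟩ := E.ne_bot_iff.1 hE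
      obtain ⟨c, d, hd, hcd⟩ := IsFractionRing.div_surjective (A := R) (x / e)
      have hd0 : algebraMap R K d ≠ 0 :=
        IsFractionRing.to_map_ne_zero_of_mem_nonZeroDivisors hd
      refine J.ne_bot_iff.2 ⟨d, (hJ d).2 ?_, nonZeroDivisors.ne_zero hd⟩
      have : algebraMap R K d * x = c • e := by
        rw [Algebra.smul_def]
        field_simp at hcd
        rw [hcd]
      rw [this]
      exact E.smul_mem c he
    by_contra hcon
    have h1 : 1 ∉ s.finiteType (coeSubmodule K J) := by
      rintro ⟨F, hF, hFJ, h1F⟩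
      refine hcon ⟨F, hF, hFJ.trans (coeSubmodule_le_one J), h1F, fun y hy => ?_⟩
      obtain ⟨a, ha, rfl⟩ := (mem_coeSubmodule K _).1 (hFJ hy)
      exact (hJ a).1 ha
    obtain ⟨M, hM, hJM⟩ := s.exists_isQuasiMaximal hJ0 h1
    obtain ⟨a, ha, hax⟩ := hx ⟨M, hM.isPrime⟩ hM
    exact ha (hJM ((hJ a).2 hax))
  · rintro ⟨F, hF, hF1, h1F, hFx⟩
    by_cases hE : E = ⊥
    · subst hE
      have hF0 : F ≠ ⊥ := by
        rintro rfl
        rw [map_bot] at h1F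
        exact one_ne_zero h1F
      obtain ⟨y, hy, hy0⟩ := F.ne_bot_iff.1 hF0
      rcases mul_eq_zero.1 (hFx y hy) with h | h
      · exact absurd h hy0
      · rw [h]
        exact zero_mem _
    rw [tilde, spectral, ofNeBot_apply _ _ _ _ _ hE]
    simp only [Submodule.mem_iInf, mem_localizeAt]
    intro P hP
    by_contra! hcon
    have hP' : s.finiteType.IsQuasiMaximal P.asIdeal := hP
    refine hP'.one_notMem ⟨F, hF, fun y hy => ?_, h1F⟩
    obtain ⟨a, rfl⟩ := Submodule.mem_one.1 (hF1 hy)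
    refine (mem_coeSubmodule K _).2 ⟨a, ?_, rfl⟩
    by_contra ha
    exact hcon a ha (hFx _ hy)

theorem tilde_le_finiteType (E : Submodule R K) : s.tilde E ≤ s.finiteType E := by
  intro x hx
  obtain ⟨F, hF, -, h1, hFx⟩ := s.mem_tilde_iff.1 hx
  rw [← mul_one x]
  exact s.finiteType.mul_mem_apply (E := F) (fun z hz => by rw [mul_comm]; exact hFx z hz)
    ⟨F, hF, le_rfl, h1⟩

theorem one_mem_tilde_iff {E : Submodule R K} (hE : E ≤ 1) :
    1 ∈ s.tilde E ↔ 1 ∈ s.finiteType E := by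
  refine ⟨fun h => s.tilde_le_finiteType E h, ?_⟩
  rintro ⟨F, hF, hFE, h1⟩
  exact s.mem_tilde_iff.2 ⟨F, hF, hFE.trans hE, h1, fun y hy => by simpa using hFE hy⟩

theorem finiteType_tilde : s.tilde.finiteType = s.tilde := by
  ext E x
  refine ⟨fun hx => s.tilde.finiteType_le E hx, fun hx => ?_⟩
  obtain ⟨F, hF, hF1, h1, hFx⟩ := s.mem_tilde_iff.1 hx
  refine ⟨F * Submodule.span R {x}, hF.mul (Submodule.fg_span_singleton x), ?_,
    s.mem_tilde_iff.2 ⟨F, hF, hF1, h1, fun y hy =>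
      Submodule.mul_mem_mul hy (Submodule.mem_span_singleton_self x)⟩⟩
  rw [Submodule.mul_le]
  intro y hy z hz
  obtain ⟨c, rfl⟩ := Submodule.mem_span_singleton.1 hz
  rw [mul_smul_comm]
  exact E.smul_mem c (hFx y hy)

/-- One finitely generated `F` serves for all elements of a finitely generated submodule. -/
theorem exists_mul_le_of_fg_le_tilde {G E : Submodule R K} (hG : G.FG) (hGE : G ≤ s.tilde E) :
    ∃ F : Submodule R K, F.FG ∧ F ≤ 1 ∧ 1 ∈ s F ∧ F * G ≤ E := by
  induction G, hG using Submodule.fg_induction with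
  | singleton x =>
    obtain ⟨F, hF, hF1, h1, hFx⟩ := s.mem_tilde_iff.1 (hGE (Submodule.mem_span_singleton_self x))
    refine ⟨F, hF, hF1, h1, Submodule.mul_le.2 fun y hy z hz => ?_⟩
    obtain ⟨c, rfl⟩ := Submodule.mem_span_singleton.1 hz
    rw [mul_smul_comm]
    exact E.smul_mem c (hFx y hy)
  | sup A B hA hB ihA ihB =>
    obtain ⟨F, hF, hF1, h1, hFA⟩ := ihA (le_sup_left.trans hGE)
    obtain ⟨F', hF', hF1', h1', hFB⟩ := ihB (le_sup_right.trans hGE)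
    refine ⟨F * F', hF.mul hF', (mul_le_mul' hF1 hF1').trans (one_mul _).le,
      s.one_mem_apply_mul h1 h1', ?_⟩
    rw [Submodule.mul_sup]
    refine sup_le ?_ ?_
    · rw [mul_comm F, mul_assoc]
      exact (mul_le_mul' hF1' hFA).trans (one_mul _).le
    · rw [mul_assoc]
      exact (mul_le_mul' hF1 hFB).trans (one_mul _).le

/-- The defining property of a P`⋆`MD extends from ideals to finitely generated fractional
ideals. -/
theorem isPruferMultiplicationDomain_iff : s.IsPruferMultiplicationDomain ↔
    ∀ E : Submodule R K, E ≠ ⊥ → E.FG → 1 ∈ s.finiteType (E * (1 / E)) := by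
  constructor
  · intro h E hE hfg
    obtain ⟨d, hd, hdE⟩ := FractionalIdeal.isFractional_of_fg (S := nonZeroDivisors R) hfg
    have hd0 : algebraMap R K d ≠ 0 := IsFractionRing.to_map_ne_zero_of_mem_nonZeroDivisors hd
    have hle : algebraMap R K d • E ≤ 1 := by
      intro x hx
      rw [mem_smul_iff hd0] at hx
      obtain ⟨c, hc⟩ := hdE _ hx
      refine Submodule.mem_one.2 ⟨c, ?_⟩
      rw [hc, Algebra.smul_def, mul_inv_cancel_left₀ hd0]
    rw [← isInvertible_iff, ← isInvertible_smul _ hd0, ← coeSubmodule_comap hle]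
    refine h _ (fun h0 => smul_ne_bot hd0 hE ?_) (fg_comap (Submodule.FG.map _ hfg) hle)
    rw [← coeSubmodule_comap hle, h0, IsLocalization.coeSubmodule_bot]
  · intro h I hI hfg
    refine (isInvertible_iff _).2 (h _ (fun h0 => hI ?_) (Submodule.FG.map _ hfg))
    exact IsFractionRing.coeSubmodule_injective R K (by rw [h0, IsLocalization.coeSubmodule_bot])

/-- In a P`⋆`MD the operations `⋆_f` and `⋆~` coincide: if `x ∈ F^⋆` with `F` finitely generated,
put `E = F + xR`; then `F E⁻¹` multiplies `x` into `F`, and its `⋆_f`-closure is that of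
`E E⁻¹`. -/
theorem IsPruferMultiplicationDomain.finiteType_eq_tilde {s : SemistarOperation R K}
    (hs : s.IsPruferMultiplicationDomain) : s.finiteType = s.tilde := by
  ext E x
  refine ⟨?_, fun hx => s.tilde_le_finiteType E hx⟩
  rintro ⟨F, hF, hFE, hx⟩
  refine s.tilde.apply_mono hFE ?_
  by_cases hx0 : x = 0
  · rw [hx0]
    exact zero_mem _
  let G := F ⊔ Submodule.span R {x}
  have hxG : x ∈ G := le_sup_right (a := F) (Submodule.mem_span_singleton_self x)
  have hGF : G ≤ s.finiteType F := by
    rw [s.finiteType_of_fg hF]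
    exact sup_le (s.le_apply F) ((Submodule.span_singleton_le_iff_mem _ _).2 hx)
  have h1 := s.isPruferMultiplicationDomain_iff.1 hs G ((Submodule.ne_bot_iff _).2 ⟨x, hxG, hx0⟩)
    (hF.sup (Submodule.fg_span_singleton x))
  have h2 : G * (1 / G) ≤ s.finiteType (F * (1 / G)) :=
    (mul_le_mul' hGF (s.finiteType.le_apply _)).trans (s.finiteType.apply_mul_apply_le _ _)
  obtain ⟨H, hH, hHF, h1H⟩ := s.finiteType.apply_le_of_le h2 h1
  refine s.mem_tilde_iff.2 ⟨H, hH, ?_, h1H, fun y hy => ?_⟩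
  · exact hHF.trans ((mul_le_mul' le_sup_left le_rfl).trans Submodule.mul_one_div_le_one)
  · refine Submodule.mul_induction_on (hHF hy) (fun m hm n hn => ?_) fun a b ha hb => ?_
    · obtain ⟨c, hc⟩ := Submodule.mem_one.1 (Submodule.mem_div_iff_forall_mul_mem.1 hn x hxG)
      rw [mul_assoc, ← hc, mul_comm, ← Algebra.smul_def]
      exact F.smul_mem c hm
    · rw [add_mul]
      exact add_mem ha hb

theorem isPruferMultiplicationDomain_tilde_iff :
    s.tilde.IsPruferMultiplicationDomain ↔ s.IsPruferMultiplicationDomain := by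
  simp only [isPruferMultiplicationDomain_iff, finiteType_tilde,
    s.one_mem_tilde_iff Submodule.mul_one_div_le_one]

theorem isDedekind_tilde_iff : s.tilde.IsDedekind ↔ s.IsDedekind := by
  rw [IsDedekind, IsDedekind, isPruferMultiplicationDomain_tilde_iff]
  refine and_congr_left fun hP => ⟨fun h => ?_, fun h => ?_⟩
  · exact h.of_le fun I => (s.tilde_le_finiteType _).trans (s.finiteType_le _)
  · refine h.of_le fun I => ?_
    rw [← hP.finiteType_eq_tilde, h.finiteType_coeSubmodule I]

end Tilde

/-! ### Passage to the overring `R^{⋆~}` -/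

section Overring

variable {R K : Type*} [CommRing R] [Field K] [Algebra R K] (s : SemistarOperation R K)

theorem isFractionRing_subalgebra [IsFractionRing R K] (T : Subalgebra R K) :
    IsFractionRing T K := by
  refine IsFractionRing.of_field T K fun z => ?_
  obtain ⟨a, b, -, rfl⟩ := IsFractionRing.div_surjective (A := R) z
  exact ⟨algebraMap R T a, algebraMap R T b, rfl⟩

theorem mem_induced_iff {T : Subalgebra R K} {E : Submodule T K} {x : K} :
    x ∈ s.induced T E ↔ x ∈ s (E.restrictScalars R) := Iff.rfl

theorem finiteType_induced (h : s.finiteType = s) (T : Subalgebra R K) :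
    (s.induced T).finiteType = s.induced T := by
  ext E x
  refine ⟨fun hx => finiteType_le _ E hx, fun hx => ?_⟩
  rw [mem_induced_iff, ← h] at hx
  obtain ⟨F, hF, hFE, hx⟩ := hx
  obtain ⟨S, hS, rfl⟩ := Submodule.fg_def.1 hF
  refine ⟨Submodule.span T S, Submodule.fg_span hS,
    Submodule.span_le.2 fun y hy => hFE (Submodule.subset_span hy), ?_⟩
  rw [mem_induced_iff]
  exact s.apply_mono (Submodule.span_le_restrictScalars R T S) hx

theorem restrictScalars_one_overring :
    (1 : Submodule s.overring K).restrictScalars R = s 1 := by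
  ext x
  rw [Submodule.restrictScalars_mem, Submodule.mem_one]
  exact ⟨fun ⟨y, hy⟩ => hy ▸ y.2, fun hx => ⟨⟨x, hx⟩, rfl⟩⟩

theorem dot_one : s.dot 1 = 1 := by
  ext x
  rw [dot, mem_induced_iff, restrictScalars_one_overring, s.apply_apply,
    ← restrictScalars_one_overring, Submodule.restrictScalars_mem]

/-- The module generated by `E` over `R^⋆` lies in `E^⋆`. -/
theorem span_overring_le (E : Submodule R K) :
    (Submodule.span s.overring (E : Set K)).restrictScalars R ≤ s E := by
  intro x hx
  induction (Submodule.restrictScalars_mem R _ _).1 hx using Submodule.span_induction with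
  | mem y hy => exact s.le_apply E hy
  | zero => exact zero_mem _
  | add y z _ _ hy hz => exact add_mem (hy ‹_›) (hz ‹_›)
  | smul t y _ hy =>
    have := s.apply_mul_apply_le 1 E (Submodule.mul_mem_mul t.2 (hy ‹_›))
    rwa [one_mul] at this

variable [IsFractionRing R K] [IsDomain R]

theorem isPruferMultiplicationDomain_dot_iff :
    s.tilde.dot.IsPruferMultiplicationDomain ↔ s.tilde.IsPruferMultiplicationDomain := by
  have := isFractionRing_subalgebra s.tilde.overring
  have hdot : s.tilde.dot.finiteType = s.tilde.dot :=
    s.tilde.finiteType_induced s.finiteType_tilde _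
  rw [isPruferMultiplicationDomain_iff, isPruferMultiplicationDomain_iff, hdot,
    s.finiteType_tilde]
  constructor
  · intro h E hE hfg
    let E' := Submodule.span s.tilde.overring (E : Set K)
    have hE' : E' ≠ ⊥ := by
      obtain ⟨e, he, he0⟩ := E.ne_bot_iff.1 hE
      exact E'.ne_bot_iff.2 ⟨e, Submodule.subset_span he, he0⟩
    have hfg' : E'.FG := by
      obtain ⟨S, hS, rfl⟩ := Submodule.fg_def.1 hfg
      have : E' = Submodule.span s.tilde.overring S :=
        le_antisymm (Submodule.span_le.2 (Submodule.span_le_restrictScalars _ _ _))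
          (Submodule.span_mono Submodule.subset_span)
      rw [this]
      exact Submodule.fg_span hS
    refine s.tilde.apply_le_of_le ?_ (h E' hE' hfg')
    intro x hx
    refine Submodule.mul_induction_on ((Submodule.restrictScalars_mem R _ _).1 hx)
      (fun e he z hz => ?_) fun a b ha hb => add_mem ha hb
    refine s.tilde.apply_mul_apply_le _ _ (Submodule.mul_mem_mul
      (s.tilde.span_overring_le E he) ?_)
    -- `z E ⊆ R^{⋆~}` with `E` finitely generated, so some `F` in the localizing system has
    -- `F z E ⊆ R`, that is `F z ⊆ E⁻¹`
    have hzE : E * Submodule.span R {z} ≤ s.tilde 1 := by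
      refine Submodule.mul_le.2 fun e he w hw => ?_
      obtain ⟨c, rfl⟩ := Submodule.mem_span_singleton.1 hw
      rw [mul_smul_comm]
      refine Submodule.smul_mem _ c ?_
      have := Submodule.mem_div_iff_forall_mul_mem.1 hz e (Submodule.subset_span he)
      rw [← restrictScalars_one_overring, mul_comm]
      exact this
    obtain ⟨F, hF, hF1, h1, hFE⟩ := s.exists_mul_le_of_fg_le_tilde
      (hfg.mul (Submodule.fg_span_singleton z)) hzE
    refine s.mem_tilde_iff.2 ⟨F, hF, hF1, h1, fun y hy =>
      Submodule.mem_div_iff_forall_mul_mem.2 fun e he => ?_⟩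
    rw [mul_assoc, mul_comm z]
    exact hFE (Submodule.mul_mem_mul hy
      (Submodule.mul_mem_mul he (Submodule.mem_span_singleton_self z)))
  · intro h E hE hfg
    obtain ⟨S, hS, rfl⟩ := Submodule.fg_def.1 hfg
    have hS0 : Submodule.span R S ≠ ⊥ := by
      rw [Ne, Submodule.span_eq_bot] at hE ⊢
      exact hE
    rw [dot, mem_induced_iff]
    refine s.tilde.apply_mono (Submodule.mul_le.2 fun e he z hz => ?_)
      (h _ hS0 (Submodule.fg_span hS))
    rw [Submodule.restrictScalars_mem]
    refine Submodule.mul_mem_mul (Submodule.span_le_restrictScalars R s.tilde.overring S he) ?_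
    refine Submodule.mem_div_iff_forall_mul_mem.2 fun w hw => ?_
    induction hw using Submodule.span_induction with
    | mem y hy =>
      obtain ⟨c, hc⟩ := Submodule.mem_one.1
        (Submodule.mem_div_iff_forall_mul_mem.1 hz y (Submodule.subset_span hy))
      rw [← hc]
      exact Submodule.mem_one.2 ⟨algebraMap R _ c, rfl⟩
    | zero => simp
    | add y w _ _ hy hw =>
      rw [mul_add]
      exact add_mem hy hw
    | smul t y _ hy =>
      rw [mul_smul_comm]
      exact Submodule.smul_mem _ t hy

/-- Stability of `⋆~` on elements of `R^{⋆~}`: it suffices to test the multiples lying in `R`. -/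
theorem mem_tilde_of_mem_tilde_one {x : K} {E : Submodule R K} (hx : x ∈ s.tilde 1)
    (h : ∀ y : R, algebraMap R K y * x ∈ (1 : Submodule R K) → algebraMap R K y * x ∈ E) :
    x ∈ s.tilde E := by
  obtain ⟨F, hF, hF1, h1, hFx⟩ := s.mem_tilde_iff.1 hx
  refine s.mem_tilde_iff.2 ⟨F, hF, hF1, h1, fun y hy => ?_⟩
  obtain ⟨a, rfl⟩ := Submodule.mem_one.1 (hF1 hy)
  exact h a (hFx _ hy)

/-- Contraction is injective on quasi-ideals of `R^{⋆~}`, and every quasi-`⋆~`-ideal of `R` is the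
contraction of the closure of its extension. -/
theorem isNoetherianDomain_dot_iff :
    s.tilde.dot.IsNoetherianDomain ↔ s.tilde.IsNoetherianDomain := by
  constructor
  · intro h I hI hq
    let f := algebraMap R s.tilde.overring
    have hf : Function.Injective f := fun a b hab =>
      IsFractionRing.injective R K (congrArg Subtype.val hab)
    have hle : ∀ n, (coeSubmodule K ((I n).map f)).restrictScalars R
        ≤ s.tilde (coeSubmodule K (I n)) := by
      intro n
      refine le_trans ?_ (s.tilde.span_overring_le _)
      intro x hx
      obtain ⟨t, ht, rfl⟩ := (mem_coeSubmodule K _).1 hx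
      induction ht using Submodule.span_induction with
      | mem y hy =>
        obtain ⟨a, ha, rfl⟩ := hy
        exact Submodule.subset_span ((mem_coeSubmodule K _).2 ⟨a, ha, rfl⟩)
      | zero => exact zero_mem _
      | add y z hy' hz' hy hz =>
        rw [map_add]
        exact add_mem (hy ((mem_coeSubmodule K _).2 ⟨y, hy', rfl⟩))
          (hz ((mem_coeSubmodule K _).2 ⟨z, hz', rfl⟩))
      | smul t y hy' hy =>
        rw [smul_eq_mul, map_mul, ← Algebra.smul_def]
        exact Submodule.smul_mem _ t (hy ((mem_coeSubmodule K _).2 ⟨y, hy', rfl⟩))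
    have hcomap : ∀ n, (s.tilde.dot.trace ((I n).map f)).comap f = I n := by
      intro n
      apply le_antisymm
      · intro a ha
        exact (hq n).2.ge (s.tilde.apply_le_of_le (hle n) ha)
      · exact Ideal.map_le_iff_le_comap.1 (le_trace _ _)
    obtain ⟨n, hn⟩ := h (fun n => s.tilde.dot.trace ((I n).map f))
      (fun i j hij => trace_mono _ (Ideal.map_mono (hI hij)))
      (fun n => isQuasiIdeal_trace _ fun h0 => (hq n).1
        ((Ideal.map_eq_bot_iff_of_injective hf).1 h0))
    refine ⟨n, fun m hm => ?_⟩
    have := congrArg (Ideal.comap f) (hn m hm)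
    simpa only [hcomap] using this
  · intro h I hI hq
    let f := algebraMap R s.tilde.overring
    have hcoe : ∀ n, coeSubmodule K ((I n).comap f)
        ≤ (coeSubmodule K (I n)).restrictScalars R := by
      intro n x hx
      obtain ⟨a, ha, rfl⟩ := (mem_coeSubmodule K _).1 hx
      exact (mem_coeSubmodule K _).2 ⟨f a, ha, rfl⟩
    obtain ⟨n, hn⟩ := h (fun n => (I n).comap f) (fun i j hij => Ideal.comap_mono (hI hij)) (by
      intro n
      refine (isQuasiIdeal_iff _).2 ⟨?_, fun a ha => ?_⟩
      · obtain ⟨x, hx, hx0⟩ := (I n).ne_bot_iff.1 (hq n).1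
        obtain ⟨a, b, hb, hab⟩ := IsFractionRing.div_surjective (A := R) (x : K)
        have hb0 : algebraMap R K b ≠ 0 :=
          IsFractionRing.to_map_ne_zero_of_mem_nonZeroDivisors hb
        have e : f a = f b * x := by
          apply Subtype.ext
          change algebraMap R K a = algebraMap R K b * x
          rw [← hab]
          field_simp
        refine (Submodule.ne_bot_iff _).2 ⟨a, ?_, fun h0 => ?_⟩
        · rw [Ideal.mem_comap, e]
          exact (I n).mul_mem_left _ hx
        · rw [h0, map_zero, zero_div] at hab
          exact hx0 (Subtype.ext hab.symm)
      · exact (hq n).2.ge (s.tilde.apply_mono (hcoe n) ha))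
    refine ⟨n, fun m hm => le_antisymm (fun x hx => ?_) (hI hm)⟩
    have key : (x : K) ∈ s.tilde (coeSubmodule K ((I n).comap f)) := by
      refine s.mem_tilde_of_mem_tilde_one x.2 fun a ha => ?_
      obtain ⟨c, hc⟩ := Submodule.mem_one.1 ha
      rw [← hn m hm]
      refine (mem_coeSubmodule K _).2 ⟨c, ?_, hc⟩
      have e : f c = f a * x := Subtype.ext hc
      rw [Ideal.mem_comap, e]
      exact (I m).mul_mem_left _ hx
    exact (hq n).2.ge (s.tilde.apply_mono (hcoe n) key)

theorem isDedekind_dot_iff : s.tilde.dot.IsDedekind ↔ s.tilde.IsDedekind :=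
  and_congr s.isNoetherianDomain_dot_iff s.isPruferMultiplicationDomain_dot_iff

end Overring

/-! ### Comparison with the `t`-operation -/

section TOperation

variable {R K : Type*} [CommRing R] [Field K] [Algebra R K]

theorem mem_vOperation_iff {E : Submodule R K} (hE : E ≠ ⊥) {x : K} :
    x ∈ vOperation R K E ↔ ∀ y ∈ 1 / E, x * y ∈ (1 : Submodule R K) := by
  rw [vOperation, ofNeBot_apply _ _ _ _ _ hE, Submodule.mem_div_iff_forall_mul_mem]

theorem apply_le_vOperation {s : SemistarOperation R K} (h1 : s 1 = 1) (E : Submodule R K) :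
    s E ≤ vOperation R K E := by
  by_cases hE : E = ⊥
  · rw [hE, map_bot, map_bot]
  intro x hx
  rw [mem_vOperation_iff hE]
  intro y hy
  rw [mul_comm, ← h1]
  exact s.mul_mem_apply (Submodule.mem_div_iff_forall_mul_mem.1 hy) hx

/-- If `R^⋆ = R` and `R` is a P`⋆`MD, then `⋆_f` is the `t`-operation: `F^v F⁻¹ ⊆ R` gives
`F^v (F F⁻¹) ⊆ F`, and `(F F⁻¹)^{⋆_f} = R`. -/
theorem IsPruferMultiplicationDomain.finiteType_eq_tOperation [IsDomain R] [IsFractionRing R K]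
    {s : SemistarOperation R K} (hs : s.IsPruferMultiplicationDomain) (h1 : s 1 = 1) :
    s.finiteType = tOperation R K := by
  have key : ∀ F : Submodule R K, F.FG → vOperation R K F = s F := by
    intro F hF
    refine le_antisymm (fun x hx => ?_) (apply_le_vOperation h1 F)
    by_cases hF0 : F = ⊥
    · rwa [hF0, map_bot] at hx ⊢
    rw [mem_vOperation_iff hF0] at hx
    have h := s.finiteType_le _ (s.isPruferMultiplicationDomain_iff.1 hs F hF0 hF)
    rw [← mul_one x]
    refine s.mul_mem_apply (fun z hz => ?_) h
    refine Submodule.mul_induction_on hz (fun m hm n hn => ?_) fun a b ha hb => ?_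
    · obtain ⟨c, hc⟩ := Submodule.mem_one.1 (hx n hn)
      rw [mul_comm m, ← mul_assoc, ← hc, ← Algebra.smul_def]
      exact F.smul_mem c hm
    · rw [mul_add]
      exact add_mem ha hb
  ext E x
  exact exists_congr fun F => and_congr_right fun hF => by rw [key F hF]

end TOperation

/-! ### A `⋆`-Dedekind domain with `R^⋆ = R` is a Krull domain -/

section Krull

variable {R K : Type*} [CommRing R] [Field K] [Algebra R K] [IsFractionRing R K]

/-- The prime `P` has the property that every nonzero ideal `I` satisfies `I I⁻¹ ⊈ P`; that is,
each nonzero ideal becomes principal in `R_P`. Here `b ∈ I⁻¹` and `a b = c ∉ P`, so that `a`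
generates `I R_P`. -/
def IsLocallyPrincipalAt (K : Type*) [Field K] [Algebra R K] (P : Ideal R) : Prop :=
  ∀ I : Ideal R, I ≠ ⊥ → ∃ a ∈ I, ∃ b : K, ∃ c ∉ P, algebraMap R K a * b = algebraMap R K c ∧
    ∀ y ∈ I, ∃ d : R, algebraMap R K y * b = algebraMap R K d

theorem IsDedekind.isLocallyPrincipalAt {s : SemistarOperation R K} (hs : s.IsDedekind)
    (h1 : s 1 = 1) (hf : s.finiteType = s) {P : Ideal R} (hP : s.IsQuasiMaximal P) :
    IsLocallyPrincipalAt K P := by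
  intro I hI
  obtain ⟨J, hJI, hJ, hIJ⟩ := hs.1.exists_fg I
  have hJ0 : J ≠ ⊥ := by
    rintro rfl
    rw [IsLocalization.coeSubmodule_bot, map_bot, le_bot_iff, ← IsLocalization.coeSubmodule_bot]
      at hIJ
    exact hI (IsFractionRing.coeSubmodule_injective R K hIJ)
  have hinv := hs.2 J hJ0 hJ
  rw [hf, isInvertible_iff] at hinv
  have hnle : ¬ coeSubmodule K J * (1 / coeSubmodule K J) ≤ coeSubmodule K P := fun h =>
    hP.one_notMem (s.apply_mono h hinv)
  rw [Submodule.mul_le] at hnle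
  push Not at hnle
  obtain ⟨x, hx, b, hb, hxb⟩ := hnle
  obtain ⟨a, ha, rfl⟩ := (mem_coeSubmodule K _).1 hx
  have hbI : ∀ y ∈ I, ∃ d : R, algebraMap R K y * b = algebraMap R K d := by
    intro y hy
    have h := s.mul_mem_apply (Submodule.mem_div_iff_forall_mul_mem.1 hb)
      (hIJ ((mem_coeSubmodule K _).2 ⟨y, hy, rfl⟩))
    rw [h1] at h
    obtain ⟨d, hd⟩ := Submodule.mem_one.1 h
    exact ⟨d, by rw [hd, mul_comm]⟩
  obtain ⟨c, hc⟩ := hbI a (hJI ha)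
  exact ⟨a, hJI ha, b, c, fun hcP => hxb ((mem_coeSubmodule K _).2 ⟨c, hcP, hc.symm⟩), hc, hbI⟩

variable {P : Ideal R}

theorem algebraMap_ne_zero_of_notMem {a : R} (ha : a ∉ P) : algebraMap R K a ≠ 0 := fun h =>
  ha ((IsFractionRing.injective R K (h.trans (map_zero _).symm)) ▸ P.zero_mem)

/-- The localization `R_P`, as a valuation ring of `K`, when every nonzero ideal of `R` is locally
principal at `P`. -/
def IsLocallyPrincipalAt.valuationSubring [hP : P.IsPrime] (h : IsLocallyPrincipalAt K P) :
    ValuationSubring K where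
  carrier := {x | ∃ a ∉ P, ∃ c : R, algebraMap R K a * x = algebraMap R K c}
  mul_mem' := by
    rintro x y ⟨a, ha, c, hx⟩ ⟨b, hb, d, hy⟩
    refine ⟨a * b, hP.mul_notMem ha hb, c * d, ?_⟩
    rw [map_mul, map_mul, ← hx, ← hy]
    ring
  one_mem' := ⟨1, hP.one_notMem, 1, by simp⟩
  add_mem' := by
    rintro x y ⟨a, ha, c, hx⟩ ⟨b, hb, d, hy⟩
    refine ⟨a * b, hP.mul_notMem ha hb, b * c + a * d, ?_⟩
    rw [map_mul, map_add, map_mul, map_mul, ← hx, ← hy]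
    ring
  zero_mem' := ⟨1, hP.one_notMem, 0, by simp⟩
  neg_mem' := by
    rintro x ⟨a, ha, c, hx⟩
    exact ⟨a, ha, -c, by rw [map_neg, ← hx, mul_neg]⟩
  mem_or_inv_mem' := by
    intro x
    have := (algebraMap R K).domain_nontrivial
    obtain ⟨p, q, hq, rfl⟩ := IsFractionRing.div_surjective (A := R) x
    have hq0 : algebraMap R K q ≠ 0 := IsFractionRing.to_map_ne_zero_of_mem_nonZeroDivisors hq
    obtain ⟨a, ha, b, c, hc, hab, hI⟩ := h (Ideal.span {p, q}) fun h0 => hq0 (by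
      have : q ∈ Ideal.span {p, q} := Ideal.subset_span (by simp)
      rw [h0, Ideal.mem_bot] at this
      rw [this, map_zero])
    obtain ⟨d, hd⟩ := hI p (Ideal.subset_span (by simp))
    obtain ⟨e, he⟩ := hI q (Ideal.subset_span (by simp))
    obtain ⟨u, w, rfl⟩ := Ideal.mem_span_pair.1 ha
    have hc' : c = u * d + w * e := by
      apply IsFractionRing.injective R K
      rw [← hab]
      simp only [map_add, map_mul, ← hd, ← he]
      ring
    have hb0 : b ≠ 0 := by
      rintro rfl
      exact algebraMap_ne_zero_of_notMem (K := K) hc (by rw [← hab, mul_zero])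
    by_cases heP : e ∈ P
    · have hdP : d ∉ P := fun hdP => hc (hc' ▸ add_mem (P.mul_mem_left _ hdP)
        (P.mul_mem_left _ heP))
      have hp0 : algebraMap R K p ≠ 0 := fun h0 => algebraMap_ne_zero_of_notMem (K := K) hdP
        (by rw [← hd, h0, zero_mul])
      refine Or.inr ⟨d, hdP, e, ?_⟩
      rw [← hd, ← he]
      field_simp
    · refine Or.inl ⟨e, heP, d, ?_⟩
      rw [← hd, ← he]
      field_simp

theorem IsLocallyPrincipalAt.algebraMap_mem [hP : P.IsPrime] (h : IsLocallyPrincipalAt K P)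
    (a : R) : algebraMap R K a ∈ h.valuationSubring :=
  ⟨1, hP.one_notMem, a, by simp⟩

theorem IsLocallyPrincipalAt.inv_algebraMap_mem_iff [hP : P.IsPrime]
    (h : IsLocallyPrincipalAt K P) {a : R} (ha : a ≠ 0) :
    (algebraMap R K a)⁻¹ ∈ h.valuationSubring ↔ a ∉ P := by
  have ha0 : algebraMap R K a ≠ 0 := fun h0 =>
    ha (IsFractionRing.injective R K (h0.trans (map_zero _).symm))
  constructor
  · rintro ⟨b, hb, c, hbc⟩ haP
    have : b = c * a := by
      apply IsFractionRing.injective R K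
      rw [map_mul, ← hbc]
      field_simp
    exact hb (this ▸ P.mul_mem_left _ haP)
  · exact fun haP => ⟨a, haP, 1, by rw [mul_inv_cancel₀ ha0, map_one]⟩

theorem IsLocallyPrincipalAt.valuation_eq_one [P.IsPrime] (h : IsLocallyPrincipalAt K P) {a : R}
    (ha : a ∉ P) : h.valuationSubring.valuation (algebraMap R K a) = 1 := by
  have ha0 : a ≠ 0 := fun h0 => ha (h0 ▸ P.zero_mem)
  have h1 := (h.valuationSubring.valuation_le_one_iff _).2 (h.algebraMap_mem a)
  have h2 := (h.valuationSubring.valuation_le_one_iff _).2 ((h.inv_algebraMap_mem_iff ha0).2 ha)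
  rw [map_inv₀] at h2
  refine le_antisymm h1 ?_
  rwa [inv_le_one₀] at h2
  exact (Valuation.pos_iff _).2 (algebraMap_ne_zero_of_notMem ha)

theorem IsLocallyPrincipalAt.isDiscreteValuationRing [hP : P.IsPrime]
    (h : IsLocallyPrincipalAt K P) (hP0 : P ≠ ⊥) :
    IsDiscreteValuationRing h.valuationSubring := by
  have hpir : IsPrincipalIdealRing h.valuationSubring := by
    refine ⟨fun N => ?_⟩
    by_cases hN : N = ⊥
    · exact hN ▸ inferInstance
    let f : R →+* h.valuationSubring :=
      (algebraMap R K).codRestrict h.valuationSubring h.algebraMap_mem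
    have hf : ∀ a, (f a : K) = algebraMap R K a := fun _ => rfl
    -- every element of `R_P` is, up to a unit, an element of `R`
    have hclear : ∀ x ∈ N, ∃ a ∉ P, ∃ c ∈ N.comap f, algebraMap R K a * (x : K)
        = algebraMap R K c := by
      intro x hx
      obtain ⟨a, ha, c, hac⟩ := x.2
      refine ⟨a, ha, c, ?_, hac⟩
      have : f c = f a * x := Subtype.ext hac.symm
      rw [Ideal.mem_comap, this]
      exact N.mul_mem_left _ hx
    have hI : N.comap f ≠ ⊥ := by
      obtain ⟨x, hx, hx0⟩ := N.ne_bot_iff.1 hN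
      obtain ⟨a, ha, c, hc, hac⟩ := hclear x hx
      refine (Submodule.ne_bot_iff _).2 ⟨c, hc, fun h0 => ?_⟩
      rw [h0, map_zero, mul_eq_zero] at hac
      exact hac.elim (algebraMap_ne_zero_of_notMem ha) fun hx' => hx0 (Subtype.ext hx')
    obtain ⟨a, ha, b, c, hc, hab, hall⟩ := h _ hI
    refine ⟨f a, le_antisymm (fun x hx => ?_) ((Ideal.span_singleton_le_iff_mem _).2 ha)⟩
    obtain ⟨e, he, y, hy, hey⟩ := hclear x hx
    obtain ⟨d, hd⟩ := hall y hy
    have hc0 : algebraMap R K c ≠ 0 := algebraMap_ne_zero_of_notMem hc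
    have he0 : algebraMap R K e ≠ 0 := algebraMap_ne_zero_of_notMem he
    have hb0 : b ≠ 0 := by
      rintro rfl
      exact hc0 (by rw [← hab, mul_zero])
    -- `y b = d` and `a b = c` with `c ∉ P`, hence `y = a d / c`
    have hz : algebraMap R K d / (algebraMap R K (c * e)) ∈ h.valuationSubring := by
      refine ⟨c * e, hP.mul_notMem hc he, d, ?_⟩
      rw [map_mul]
      field_simp
    refine Ideal.mem_span_singleton'.2 ⟨⟨_, hz⟩, Subtype.ext ?_⟩
    change algebraMap R K d / (algebraMap R K (c * e)) * algebraMap R K a = x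
    have : (x : K) = algebraMap R K y / algebraMap R K e := by
      rw [← hey]
      field_simp
    have ha0 : algebraMap R K a ≠ 0 := by
      intro h0
      exact hc0 (by rw [← hab, h0, zero_mul])
    rw [this, map_mul, ← hab, ← hd]
    field_simp
  refine { hpir, (inferInstance : IsLocalRing h.valuationSubring) with not_a_field' := ?_ }
  obtain ⟨p, hp, hp0⟩ := P.ne_bot_iff.1 hP0
  refine (Submodule.ne_bot_iff _).2 ⟨⟨_, h.algebraMap_mem p⟩, ?_, fun h0 => ?_⟩
  · rw [IsLocalRing.mem_maximalIdeal, mem_nonunits_iff]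
    intro hu
    obtain ⟨v, hv⟩ := hu.exists_right_inv
    have hv' : algebraMap R K p * (v : K) = 1 := congrArg Subtype.val hv
    refine (h.inv_algebraMap_mem_iff hp0).1 ?_ hp
    rw [← eq_inv_of_mul_eq_one_right hv']
    exact v.2
  · exact hp0 (IsFractionRing.injective R K ((congrArg Subtype.val h0).trans (map_zero _).symm))

/-- If `R^⋆ = R` and `R` is `⋆`-Dedekind, a nonzero `a` lies in finitely many quasi-`⋆`-maximal
ideals: were there infinitely many, `P₀, P₁, …`, then the ideals
`{y | y ∈ a R_Q for all quasi-⋆-maximal Q ≠ P₀, …, P_{n-1}}` would be a strictly increasing chain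
of quasi-`⋆`-ideals. -/
theorem IsDedekind.finite_isQuasiMaximal [IsDomain R] {s : SemistarOperation R K}
    (hs : s.IsDedekind) (h1 : s 1 = 1) (hf : s.finiteType = s) {a : R} (ha : a ≠ 0) :
    {P : Ideal R | s.IsQuasiMaximal P ∧ a ∈ P}.Finite := by
  by_contra hinf
  let P : ℕ ↪ _ := Set.Infinite.natEmbedding _ hinf
  let J : ℕ → Ideal R := fun n =>
    { carrier := {y | ∀ Q : Ideal R, s.IsQuasiMaximal Q → (∀ i < n, Q ≠ P i) →
        ∃ c ∉ Q, c * y ∈ Ideal.span {a}}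
      zero_mem' := fun Q hQ _ => ⟨1, hQ.isPrime.one_notMem, by simp⟩
      add_mem' := by
        intro x y hx hy Q hQ hne
        obtain ⟨c, hc, hx⟩ := hx Q hQ hne
        obtain ⟨d, hd, hy⟩ := hy Q hQ hne
        refine ⟨c * d, hQ.isPrime.mul_notMem hc hd, ?_⟩
        have e : c * d * (x + y) = d * (c * x) + c * (d * y) := by ring
        rw [e]
        exact add_mem (Ideal.mul_mem_left _ _ hx) (Ideal.mul_mem_left _ _ hy)
      smul_mem' := by
        intro r x hx Q hQ hne
        obtain ⟨c, hc, hx⟩ := hx Q hQ hne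
        refine ⟨c, hc, ?_⟩
        rw [smul_eq_mul, mul_left_comm]
        exact Ideal.mul_mem_left _ _ hx }
  have haJ : ∀ n, a ∈ J n := fun n Q hQ _ =>
    ⟨1, hQ.isPrime.one_notMem, by simp⟩
  have hmono : Monotone J := fun m n hmn y hy Q hQ hne =>
    hy Q hQ fun i hi => hne i (hi.trans_le hmn)
  have htilde : s = s.tilde := by rw [← hs.2.finiteType_eq_tilde, hf]
  have hquasi : ∀ n, s.IsQuasiIdeal (J n) := by
    intro n
    have hJ0 : J n ≠ ⊥ := (Submodule.ne_bot_iff _).2 ⟨a, haJ n, ha⟩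
    refine s.isQuasiIdeal_iff.2 ⟨hJ0, fun y hy Q hQ hne => ?_⟩
    rw [mem_trace, htilde, mem_tilde_iff] at hy
    obtain ⟨F, hF, hF1, h1F, hFy⟩ := hy
    have hFQ : ¬ F ≤ coeSubmodule K Q := fun h => hQ.one_notMem (s.apply_mono h h1F)
    obtain ⟨z, hz, hzQ⟩ := Set.not_subset.1 hFQ
    obtain ⟨c, rfl⟩ := Submodule.mem_one.1 (hF1 hz)
    have hcQ : c ∉ Q := fun hc => hzQ ((mem_coeSubmodule K _).2 ⟨c, hc, rfl⟩)
    obtain ⟨w, hw, hwy⟩ := (mem_coeSubmodule K _).1 (hFy _ hz)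
    have hcy : w = c * y := IsFractionRing.injective R K (by rw [hwy, map_mul])
    obtain ⟨d, hd, hdw⟩ := hw Q hQ hne
    refine ⟨d * c, hQ.isPrime.mul_notMem hd hcQ, ?_⟩
    rwa [mul_assoc, ← hcy]
  obtain ⟨n, hn⟩ := hs.1 J hmono hquasi
  obtain ⟨hPn, haP⟩ := (P n).2
  -- `b ∈ Pₙ⁻¹` generates `Pₙ⁻¹` locally at `Pₙ`, and `ab` lies in `J (n + 1)` but not in `J n`
  obtain ⟨p, hp, b, e, he, hpb, hall⟩ := hs.isLocallyPrincipalAt h1 hf hPn (P n).1 hPn.prop.1.1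
  obtain ⟨y, hy⟩ := hall a haP
  have hyn : y ∈ J (n + 1) := by
    intro Q hQ hne
    have hnle : ¬ (P n : Ideal R) ≤ Q := fun h =>
      hne n n.lt_succ_self (hPn.eq_of_le hQ.prop h).symm
    obtain ⟨c, hc, hcQ⟩ := Set.not_subset.1 hnle
    obtain ⟨g, hg⟩ := hall c hc
    refine ⟨c, hcQ, Ideal.mem_span_singleton'.2 ⟨g, ?_⟩⟩
    apply IsFractionRing.injective R K
    rw [map_mul, map_mul, ← hg, ← hy]
    ring
  rw [hn (n + 1) n.le_succ] at hyn
  obtain ⟨c, hc, hcy⟩ := hyn _ hPn fun i hi h => hi.ne' (P.injective (Subtype.ext h))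
  obtain ⟨g, hg⟩ := Ideal.mem_span_singleton'.1 hcy
  have ha0 : algebraMap R K a ≠ 0 := fun h0 =>
    ha (IsFractionRing.injective R K (h0.trans (map_zero _).symm))
  have hcb : algebraMap R K c * b = algebraMap R K g := by
    apply mul_left_cancel₀ ha0
    have := congrArg (algebraMap R K) hg
    rw [map_mul, map_mul, ← hy] at this
    linear_combination -this
  have hce : c * e = g * p := by
    apply IsFractionRing.injective R K
    rw [map_mul, map_mul, ← hcb, ← hpb]
    ring
  exact hPn.isPrime.mul_notMem hc he (hce ▸ Ideal.mul_mem_left _ _ hp)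

/-- The rings `R_P`, for `P` quasi-`⋆`-maximal, are the required family of discrete valuation
rings. -/
theorem IsDedekind.isKrullDomainIn [IsDomain R] {s : SemistarOperation R K}
    (hs : s.IsDedekind) (h1 : s 1 = 1) (hf : s.finiteType = s) : IsKrullDomainIn R K := by
  have hloc : ∀ P, s.IsQuasiMaximal P → IsLocallyPrincipalAt K P := fun P hP =>
    hs.isLocallyPrincipalAt h1 hf hP
  refine ⟨{A | ∃ (P : Ideal R) (hP : s.IsQuasiMaximal P),
    A = (haveI := hP.isPrime; (hloc P hP).valuationSubring)}, ?_, ?_, ?_⟩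
  · rintro _ ⟨P, hP, rfl⟩
    have := hP.isPrime
    exact (hloc P hP).isDiscreteValuationRing hP.prop.1.1
  · intro x
    constructor
    · rintro ⟨a, rfl⟩ _ ⟨P, hP, rfl⟩
      have := hP.isPrime
      exact (hloc P hP).algebraMap_mem a
    · intro hx
      have h1s : (1 : Submodule R K) = s.tilde 1 := by
        rw [← hs.2.finiteType_eq_tilde, hf, h1]
      have hone : (1 : Submodule R K) ≠ ⊥ := (Submodule.ne_bot_iff _).2
        ⟨1, Submodule.one_le.1 le_rfl, one_ne_zero⟩
      suffices x ∈ (1 : Submodule R K) from Submodule.mem_one.1 this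
      rw [h1s, tilde, spectral, ofNeBot_apply _ _ _ _ _ hone]
      simp only [Submodule.mem_iInf, mem_localizeAt]
      intro P hP
      rw [hf] at hP
      obtain ⟨a, ha, c, hac⟩ := hx _ ⟨P.asIdeal, hP, rfl⟩
      exact ⟨a, ha, Submodule.mem_one.2 ⟨c, hac.symm⟩⟩
  · intro x hx
    obtain ⟨p, q, hq, rfl⟩ := IsFractionRing.div_surjective (A := R) x
    have hq0 : q ≠ 0 := nonZeroDivisors.ne_zero hq
    have hp0 : p ≠ 0 := by
      rintro rfl
      simp at hx
    have hfin := (hs.finite_isQuasiMaximal h1 hf hp0).union (hs.finite_isQuasiMaximal h1 hf hq0)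
    refine (hfin.dependent_image fun P hP =>
      (haveI := (hP.elim And.left And.left).isPrime
       (hloc P (hP.elim And.left And.left)).valuationSubring)).subset ?_
    rintro _ ⟨⟨P, hP, rfl⟩, hne⟩
    have := hP.isPrime
    have hPmem : P ∈ {P : Ideal R | s.IsQuasiMaximal P ∧ p ∈ P}
        ∪ {P : Ideal R | s.IsQuasiMaximal P ∧ q ∈ P} := by
      by_contra hcon
      rw [Set.mem_union, not_or] at hcon
      refine hne ?_
      rw [map_div₀, (hloc P hP).valuation_eq_one fun h => hcon.1 ⟨hP, h⟩,
        (hloc P hP).valuation_eq_one fun h => hcon.2 ⟨hP, h⟩, div_one]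
    exact ⟨P, hPmem, rfl⟩

end Krull

/-! ### A Krull domain is `t`-Dedekind -/

section KrullToDedekind

variable {R K : Type*} [CommRing R] [Field K] [Algebra R K]

/-- A discrete valuation ring is completely integrally closed: if `x` lies outside it then
`x⁻¹` is in the maximal ideal, and the powers of the maximal ideal intersect in zero. -/
theorem mem_valuationSubring_of_mul_pow_mem (A : ValuationSubring K) [IsDiscreteValuationRing A]
    {d x : K} (hd : d ≠ 0) (h : ∀ n : ℕ, d * x ^ n ∈ A) : x ∈ A := by
  by_contra hx
  have hx0 : x ≠ 0 := by
    rintro rfl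
    exact hx A.zero_mem
  have hinv : x⁻¹ ∈ A := (A.mem_or_inv_mem x).resolve_left hx
  have hmax : (⟨x⁻¹, hinv⟩ : A) ∈ IsLocalRing.maximalIdeal A := by
    rw [IsLocalRing.mem_maximalIdeal, mem_nonunits_iff]
    intro hu
    obtain ⟨v, hv⟩ := hu.exists_right_inv
    have hv' : x⁻¹ * (v : K) = 1 := congrArg Subtype.val hv
    rw [inv_mul_eq_one₀ hx0] at hv'
    exact hx (hv' ▸ v.2)
  have hdA : d ∈ A := by simpa using h 0
  have hmem : (⟨d, hdA⟩ : A) ∈ (⨅ n : ℕ, IsLocalRing.maximalIdeal A ^ n) := by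
    rw [Submodule.mem_iInf]
    intro n
    have e : (⟨d, hdA⟩ : A) = ⟨_, h n⟩ * ⟨x⁻¹, hinv⟩ ^ n := by
      apply Subtype.ext
      change d = d * x ^ n * x⁻¹ ^ n
      rw [inv_pow, mul_inv_cancel_right₀ (pow_ne_zero n hx0)]
    rw [e]
    exact Ideal.mul_mem_left _ _ (Ideal.pow_mem_pow hmax n)
  rw [Ideal.iInf_pow_eq_bot_of_isLocalRing _ (IsLocalRing.maximalIdeal.isMaximal A).ne_top] at hmem
  exact hd (congrArg Subtype.val ((Ideal.mem_bot).1 hmem))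

/-- A Krull domain is completely integrally closed. -/
theorem _root_.IsKrullDomainIn.mem_range_of_mul_pow_mem (hR : IsKrullDomainIn R K) {d x : K}
    (hd : d ≠ 0) (h : ∀ n : ℕ, d * x ^ n ∈ (1 : Submodule R K)) : x ∈ (1 : Submodule R K) := by
  obtain ⟨V, hV, hRV, -⟩ := hR
  refine Submodule.mem_one.2 ((hRV x).2 fun A hA => ?_)
  have := hV A hA
  exact mem_valuationSubring_of_mul_pow_mem A hd fun n => (hRV _).1 (Submodule.mem_one.1 (h n)) A hA

/-- Over a Krull domain every nonzero ideal is `v`-invertible: if `x E E⁻¹ ⊆ R`, then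
`x E⁻¹ ⊆ E⁻¹`, so that all powers of `x` lie in `E⁻¹`. -/
theorem _root_.IsKrullDomainIn.one_mem_vOperation (hR : IsKrullDomainIn R K) {E : Submodule R K}
    (hE : E ≠ ⊥) (hE1 : E ≤ 1) : 1 ∈ vOperation R K (E * (1 / E)) := by
  obtain ⟨d, hd, hd0⟩ := E.ne_bot_iff.1 hE
  have h1E : (1 : K) ∈ 1 / E :=
    Submodule.mem_div_iff_forall_mul_mem.2 fun y hy => by simpa using hE1 hy
  have hne : E * (1 / E) ≠ ⊥ :=
    (Submodule.ne_bot_iff _).2 ⟨d, by simpa using Submodule.mul_mem_mul hd h1E, hd0⟩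
  rw [mem_vOperation_iff hne]
  intro x hx
  rw [one_mul]
  have hstep : ∀ z ∈ 1 / E, x * z ∈ 1 / E := fun z hz =>
    Submodule.mem_div_iff_forall_mul_mem.2 fun y hy => by
      rw [mul_assoc, mul_comm z]
      exact Submodule.mem_div_iff_forall_mul_mem.1 hx _ (Submodule.mul_mem_mul hy hz)
  have hpow : ∀ n : ℕ, x ^ n ∈ 1 / E := by
    intro n
    induction n with
    | zero => simpa using h1E
    | succ n ih =>
      rw [pow_succ']
      exact hstep _ ih
  refine hR.mem_range_of_mul_pow_mem hd0 fun n => ?_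
  rw [mul_comm]
  exact Submodule.mem_div_iff_forall_mul_mem.1 (hpow n) d hd

/-- A divisorial ideal is determined by its extensions to the defining valuation rings, almost all
of which are trivial; this gives the ascending chain condition. -/
theorem _root_.IsKrullDomainIn.isNoetherianDomain_vOperation [FaithfulSMul R K]
    (hR : IsKrullDomainIn R K) : (vOperation R K).IsNoetherianDomain := by
  obtain ⟨V, hV, hRV, hfin⟩ := hR
  intro I hI hq
  obtain ⟨a, ha, ha0⟩ := (I 0).ne_bot_iff.1 (hq 0).1
  have hRA : ∀ A ∈ V, ∀ r : R, algebraMap R K r ∈ A := fun A hA r => (hRV _).1 ⟨r, rfl⟩ A hA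
  let N : ∀ A : ValuationSubring K, ℕ → Ideal A := fun A n =>
    Ideal.span {x : A | (x : K) ∈ coeSubmodule K (I n)}
  have hN : ∀ A, Monotone (N A) := fun A m n hmn => Ideal.span_mono fun x hx =>
    IsLocalization.coeSubmodule_mono K (hI hmn) hx
  have hstab : ∀ A ∈ V, ∃ n, ∀ m, n ≤ m → N A m = N A n := by
    intro A hA
    have := hV A hA
    obtain ⟨n, hn⟩ := monotone_stabilizes_iff_noetherian.2
      (inferInstance : IsNoetherian A A) ⟨N A, hN A⟩
    exact ⟨n, fun m hm => (hn m hm).symm⟩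
  have ha0' : algebraMap R K a ≠ 0 := by
    rwa [Ne, FaithfulSMul.algebraMap_eq_zero_iff]
  have htop : ∀ A ∈ V, A.valuation (algebraMap R K a) = 1 → ∀ n, N A n = ⊤ := by
    intro A hA hAa n
    refine Ideal.eq_top_of_isUnit_mem (x := ⟨_, hRA A hA a⟩) _ (Ideal.subset_span ?_)
      ((A.valuation_eq_one_iff _).2 hAa)
    exact (mem_coeSubmodule K _).2 ⟨a, hI n.zero_le ha, rfl⟩
  choose! k hk using hstab
  obtain ⟨n, hn⟩ := ((hfin _ ha0').image k).bddAbove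
  have hall : ∀ A ∈ V, ∀ m, n ≤ m → N A m = N A n := by
    intro A hA m hm
    by_cases hAa : A.valuation (algebraMap R K a) = 1
    · rw [htop A hA hAa, htop A hA hAa]
    · have hkn : k A ≤ n := hn ⟨A, ⟨hA, hAa⟩, rfl⟩
      rw [hk A hA m (hkn.trans hm), hk A hA n hkn]
  refine ⟨n, fun m hm => le_antisymm (fun x hx => ?_) (hI hm)⟩
  have hne : coeSubmodule K (I n) ≠ ⊥ := (Submodule.ne_bot_iff _).2
    ⟨_, (mem_coeSubmodule K _).2 ⟨a, hI n.zero_le ha, rfl⟩, ha0'⟩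
  refine (hq n).2.ge ?_
  rw [mem_trace, mem_vOperation_iff hne]
  intro y hy
  refine Submodule.mem_one.2 ((hRV _).2 fun A hA => ?_)
  have hxN : (⟨_, hRA A hA x⟩ : A) ∈ N A n := by
    rw [← hall A hA m hm]
    exact Ideal.subset_span ((mem_coeSubmodule K _).2 ⟨x, hx, rfl⟩)
  have key : ∀ z ∈ N A n, (z : K) * y ∈ A := by
    intro z hz
    induction hz using Submodule.span_induction with
    | mem z hz =>
      rw [mul_comm]
      exact (hRV _).1 (Submodule.mem_one.1
        (Submodule.mem_div_iff_forall_mul_mem.1 hy _ hz)) A hA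
    | zero => simp
    | add z w _ _ hz hw =>
      change ((z : K) + w) * y ∈ A
      rw [add_mul]
      exact A.add_mem _ _ hz hw
    | smul c z _ hz =>
      change ((c : K) * z) * y ∈ A
      rw [mul_assoc]
      exact A.mul_mem _ _ c.2 hz
  exact key _ hxN

theorem _root_.IsKrullDomainIn.isDedekind_tOperation [IsFractionRing R K]
    (hR : IsKrullDomainIn R K) : (tOperation R K).IsDedekind := by
  have hv := hR.isNoetherianDomain_vOperation
  have htv : ∀ I : Ideal R, tOperation R K (coeSubmodule K I) = vOperation R K (coeSubmodule K I) :=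
    hv.finiteType_coeSubmodule
  refine ⟨hv.of_le fun I => (htv I).ge, fun I hI _ => ?_⟩
  rw [tOperation, finiteType_finiteType, isInvertible_iff,
    ← coeSubmodule_comap (Submodule.mul_one_div_le_one (I := coeSubmodule K I))]
  refine (htv _).ge ?_
  rw [coeSubmodule_comap Submodule.mul_one_div_le_one]
  refine hR.one_mem_vOperation (fun h0 => hI ?_) (coeSubmodule_le_one I)
  exact IsFractionRing.coeSubmodule_injective R K (by rw [h0, IsLocalization.coeSubmodule_bot])

end KrullToDedekind

end SemistarOperation

theorem corollary4p20 {D : Type*} {K : Type*} [CommRing D] [IsDomain D] [Field K] [Algebra D K]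
    [IsFractionRing D K] (s : SemistarOperation D K) :
    List.TFAE [
      s.IsDedekind,
      s.tilde.IsDedekind,
      s.tilde.dot.IsDedekind,
      IsKrullDomainIn s.tilde.overring K ∧
        s.tilde.dot = SemistarOperation.tOperation s.tilde.overring K] := by
  have := SemistarOperation.isFractionRing_subalgebra s.tilde.overring
  have hf : s.tilde.dot.finiteType = s.tilde.dot :=
    s.tilde.finiteType_induced s.finiteType_tilde _
  tfae_have 1 ↔ 2 := s.isDedekind_tilde_iff.symm
  tfae_have 2 ↔ 3 := s.isDedekind_dot_iff.symm
  tfae_have 3 → 4 := fun h => ⟨h.isKrullDomainIn s.tilde.dot_one hf, by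
    rw [← h.2.finiteType_eq_tOperation s.tilde.dot_one, hf]⟩
  tfae_have 4 → 3 := fun ⟨hK, ht⟩ => ht ▸ hK.isDedekind_tOperation
  tfae_finish
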